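/- Let $N_n,N_f\ge 1$ be integers, let $\Omega_p,\Omega_n,\Omega_f,I>0$, and let $a_n,a_f>0$ with $a_n+a_f=1$. Let $h_p\sim\mathcal{CN}(0,\Omega_p)$, $h_{n,i}\sim\mathcal{CN}(0,\Omega_n)$ $(1\le i\le N_n)$ and $h_{f,j}\sim\mathcal{CN}(0,\Omega_f)$ $(1\le j\le N_f)$ be mutually independent circularly symmetric complex Gaussian random variables (so that $\mathbb E|h_p|^2=\Omega_p$, etc.), and put $g_p=|h_p|^2$, $g_n=\sum_i|h_{n,i}|^2$, $g_f=\sum_j|h_{f,j}|^2$, $g_{\min}=\min\{g_n,g_f\}$. Let $$C_{\mathrm{sum}}=\max_{P_t}\ \mathbb E\left\{\log_2\left[1+a_ng_nP_t(g_p)\right]+\log_2\left[1+\frac{a_fg_{\min}P_t(g_p)}{a_ng_{\min}P_t(g_p)+1}\right]\right\},$$ the maximum being over all measurable power policies $P_t(g_p)\ge 0$ with $g_pP_t(g_p)\le I$. Then the expectation is finite for every such policy, and the maximum is attained at $P_t(g_p)=I/g_p$. For an integer $M\ge1$ and $x>0$ write $$G_M(x)=G^{3,2}_{3,3}\left(x\,\middle|\,\begin{matrix}-M,&-M,&1-M\\0,&-M,&-M\end{matrix}\right)=\frac1{2\pi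 i}\int_{c-i\infty}^{c+i\infty}\frac{\Gamma(-s)\,\Gamma(-M-s)^2\,\Gamma(1+M+s)^2}{\Gamma(1-M-s)}\,x^s\,ds$$ for Meijer's G-function, where $-M-1<c<-M$; the integral converges absolutely and does not depend on $c$. With $\Omega=\Omega_n\Omega_f/(\Omega_n+\Omega_f)$, $$\begin{aligned}C_{\mathrm{sum}}=\frac1{\ln 2}\Bigg[&\frac1{\Gamma(N_n)}\left(\frac{\Omega_p}{\Omega_na_nI}\right)^{N_n}G_{N_n}\!\left(\frac{\Omega_p}{\Omega_na_nI}\right)\\&+\sum_{k=0}^{N_f-1}\frac{\Omega_p^{N_n+k}}{\Gamma(N_n)\,k!\,\Omega_n^{N_n}\Omega_f^kI^{N_n+k}}\left\{G_{N_n+k}\!\left(\frac{\Omega_p}{\Omega I}\right)-\frac1{a_n^{N_n+k}}G_{N_n+k}\!\left(\frac{\Omega_p}{\Omega a_nI}\right)\right\}\\&+\sum_{l=0}^{N_n-1}\frac{\Omega_p^{N_f+l}}{\Gamma(N_f)\,l!\,\Omega_f^{N_f}\Omega_n^lI^{N_f+l}}\left\{G_{N_f+l}\!\left(\frac{\Omega_p}{\Omega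 I}\right)-\frac1{a_n^{N_f+l}}G_{N_f+l}\!\left(\frac{\Omega_p}{\Omega a_nI}\right)\right\}\Bigg].\end{aligned}$$ -/

import Mathlib

open MeasureTheory ProbabilityTheory

noncomputable section

/-- The Mellin-Barnes integrand of the Meijer G-function `G^{m,n}_{p,q}(z | a; b)`:
`∏_{j ≤ m} Γ(b_j - s) ∏_{j ≤ n} Γ(1 - a_j + s) z^s` divided by
`∏_{j > m} Γ(1 - b_j + s) ∏_{j > n} Γ(a_j - s)`.
(Mathlib has `Γ = 0` at the poles of `Γ`, so that division by `Γ` gives the entire function `1/Γ`.) -/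
def meijerIntegrand (m n : ℕ) {p q : ℕ} (a : Fin p → ℂ) (b : Fin q → ℂ) (z s : ℂ) : ℂ :=
  ((∏ j ∈ Finset.univ.filter (fun j : Fin q => (j : ℕ) < m), Complex.Gamma (b j - s)) *
    (∏ j ∈ Finset.univ.filter (fun j : Fin p => (j : ℕ) < n), Complex.Gamma (1 - a j + s))) /
  ((∏ j ∈ Finset.univ.filter (fun j : Fin q => m ≤ (j : ℕ)), Complex.Gamma (1 - b j + s)) *
    (∏ j ∈ Finset.univ.filter (fun j : Fin p => n ≤ (j : ℕ)), Complex.Gamma (a j - s))) * z ^ s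

/-- The vertical line `Re s = c` separates the poles `b_j, b_j + 1, …` of the `Γ(b_j - s)`, `j ≤ m`
(on its right) from the poles `a_j - 1, a_j - 2, …` of the `Γ(1 - a_j + s)`, `j ≤ n` (on its left). -/
def SeparatesPoles (m n : ℕ) {p q : ℕ} (a : Fin p → ℂ) (b : Fin q → ℂ) (c : ℝ) : Prop :=
  (∀ j : Fin q, (j : ℕ) < m → c < (b j).re) ∧ (∀ j : Fin p, (j : ℕ) < n → (a j).re - 1 < c)

/-- The Mellin-Barnes integral `(1 / 2πi) ∫ … ds` along the line `Re s = c`, oriented upwards;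
with `s = c + i y` one has `ds = i dy`. -/
def meijerLineIntegral (m n : ℕ) {p q : ℕ} (a : Fin p → ℂ) (b : Fin q → ℂ) (z : ℂ) (c : ℝ) : ℂ :=
  (1 / (2 * Real.pi : ℂ)) * ∫ y : ℝ, meijerIntegrand m n a b z (c + y * Complex.I)

open Classical in
/-- Meijer's function `G^{m,n}_{p,q}(z | a; b)`, for parameters whose two families of poles can be
separated by a vertical line: the Mellin-Barnes integral along such a line. -/
def meijerG (m n : ℕ) {p q : ℕ} (a : Fin p → ℂ) (b : Fin q → ℂ) (z : ℂ) : ℂ :=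
  if h : ∃ c : ℝ, SeparatesPoles m n a b c then meijerLineIntegral m n a b z h.choose else 0

/-- `G^{m,n}_{p,q}(z | a; b)` is well defined with value `w`: a separating vertical line exists, and
along each such line the Mellin-Barnes integral converges absolutely and has the value `w`. -/
def HasMeijerG (m n : ℕ) {p q : ℕ} (a : Fin p → ℂ) (b : Fin q → ℂ) (z w : ℂ) : Prop :=
  (∃ c : ℝ, SeparatesPoles m n a b c) ∧
  ∀ c : ℝ, SeparatesPoles m n a b c →
    Integrable (fun y : ℝ => meijerIntegrand m n a b z (c + y * Complex.I)) ∧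
    meijerLineIntegral m n a b z c = w

/-- The upper parameters `-M, -M, 1 - M`. -/
def upperParams (M : ℕ) : Fin 3 → ℂ := ![-(M : ℂ), -(M : ℂ), 1 - (M : ℂ)]

/-- The lower parameters `0, -M, -M`. -/
def lowerParams (M : ℕ) : Fin 3 → ℂ := ![0, -(M : ℂ), -(M : ℂ)]

/-- `G^{3,2}_{3,3}(x | -M, -M, 1 - M; 0, -M, -M)` at a real argument `x`. -/
def rateG (M : ℕ) (x : ℝ) : ℂ := meijerG 3 2 (upperParams M) (lowerParams M) (x : ℂ)

/-- The circularly symmetric complex Gaussian law `𝒞𝒩(0, v)`, with `E |h|² = v`: real and imaginary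
parts are independent centred real Gaussians of variance `v / 2`. -/
def circularGaussian (v : ℝ) : Measure ℂ :=
  ((gaussianReal 0 (v / 2).toNNReal).prod (gaussianReal 0 (v / 2).toNNReal)).map
    (fun r : ℝ × ℝ => (r.1 : ℂ) + (r.2 : ℂ) * Complex.I)

variable {S : Type*}

/-- The channel gain `𝐡ᴴ 𝐡 = ∑ i, |h_i|²` after maximal-ratio combining. -/
def mrcGain {N : ℕ} (h : Fin N → S → ℂ) (ω : S) : ℝ := ∑ i, ‖h i ω‖ ^ 2

/-- The instantaneous NOMA sum-rate for channel gains `gn`, `gf` and transmit power `P`. -/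
def sumRate (an af gn gf P : ℝ) : ℝ :=
  Real.logb 2 (1 + an * gn * P) +
    Real.logb 2 (1 + af * min gn gf * P / (an * min gn gf * P + 1))

/-- The random instantaneous NOMA sum-rate when the transmitter, knowing the interference-link gain
`g_p = |h_p|²`, uses the power `P g_p`. -/
def randomSumRate {Nn Nf : ℕ} (an af : ℝ) (hp : S → ℂ) (hn : Fin Nn → S → ℂ) (hf : Fin Nf → S → ℂ)
    (P : ℝ → ℝ) (ω : S) : ℝ :=
  sumRate an af (mrcGain hn ω) (mrcGain hf ω) (P (‖hp ω‖ ^ 2))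

/-- The expected NOMA sum-rate of the power policy `P`. -/
def expectedSumRate [MeasurableSpace S] (μ : Measure S) {Nn Nf : ℕ} (an af : ℝ) (hp : S → ℂ)
    (hn : Fin Nn → S → ℂ) (hf : Fin Nf → S → ℂ) (P : ℝ → ℝ) : ℝ :=
  ∫ ω, randomSumRate an af hp hn hf P ω ∂μ

/-- Power policies `P_t(g_p) ≥ 0` obeying the peak-interference constraint `g_p P_t(g_p) ≤ I`. -/
def IsAdmissiblePolicy (I : ℝ) (P : ℝ → ℝ) : Prop :=
  Measurable P ∧ ∀ g : ℝ, 0 ≤ g → 0 ≤ P g ∧ g * P g ≤ I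

end

open Complex (I)
open Set

/-! For fixed gains the sum-rate increases with the power, so almost surely no admissible policy
beats `I / g_p`, and only the value of that policy remains to be computed. Since `a_n + a_f = 1`,
its rate is a combination of three terms `log (1 + β X / g_p)`, where `X` is `g_n` or `g_min`
(`sumRate_eq`).

The gains have Erlang laws (`hasLaw_mrcGain`), so the densities of `g_n` and `g_min` are finite
combinations of `x ^ (M - 1) * exp (-z x)`. Averaging first over the exponential variable `g_p`
turns the logarithm into `expLogMean`, and averaging over `X` then gives values of its Laplace
transform `laplaceExpLogMean M`.

That transform is the Meijer function. Starting from `exp (-x)`, each of `1 / (1 + x)`, `log (1 +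
x)`, `expLogMean` and `laplaceExpLogMean M` is a multiplicative convolution, up to inversions and
powers of `x`, so `hasMellin_multiplicativeConvolution` yields its Mellin transform as a product of
Gamma factors. At `M + w` with `0 < Re w < 1` the last one is `Γ(M + w) Γ(w) Γ(1 - w)² / w`, which
is the Mellin-Barnes integrand at `s = -(M + w)` without its power of `x`. Mellin inversion
concludes (`meijerLineIntegral_params`). -/

/-! ### Multiplicative convolution and elementary Mellin transforms. -/

/-- Fubini: for fixed `u`, the substitution `x ↦ x * u` separates the double integral into the two
Mellin integrals, and the Jacobian shifts the weight on `g` to the exponent `1 - s`. -/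
theorem hasMellin_multiplicativeConvolution {f g : ℝ → ℂ} {s : ℂ} (hfm : Measurable f)
    (hgm : Measurable g) (hf : MellinConvergent f s) (hg : MellinConvergent g (1 - s)) :
    HasMellin (fun x => ∫ u in Ioi (0 : ℝ), f (x * u) * g u) s
      (mellin f s * mellin g (1 - s)) := by
  set ν := (volume : Measure ℝ).restrict (Ioi 0) with hν
  let H : ℝ × ℝ → ℂ := fun p => (p.2 : ℂ) ^ (s - 1) * (f (p.2 * p.1) * g p.1)
  have hpow : Measurable fun x : ℝ => (x : ℂ) ^ (s - 1) := by fun_prop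
  have hHm : Measurable H :=
    (hpow.comp measurable_snd).mul
      ((hfm.comp (measurable_snd.mul measurable_fst)).mul (hgm.comp measurable_fst))
  let φ : ℝ → ℂ := fun x => (x : ℂ) ^ (s - 1) * f x
  have hφ : IntegrableOn φ (Ioi 0) := hf
  have hH : ∀ u ∈ Ioi (0 : ℝ), ∀ x ∈ Ioi (0 : ℝ),
      H (u, x) = φ (x * u) * ((u : ℂ) ^ (1 - s) * g u) := by
    intro u hu x hx
    simp only [H, φ]
    have hu' : (u : ℂ) ≠ 0 := by exact_mod_cast (ne_of_gt hu)
    have : (u : ℂ) ^ (s - 1) * (u : ℂ) ^ (1 - s) = 1 := by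
      rw [← Complex.cpow_add _ _ hu']; simp
    rw [Complex.ofReal_mul, Complex.mul_cpow_ofReal_nonneg (le_of_lt hx) (le_of_lt hu)]
    linear_combination (-(x : ℂ) ^ (s - 1) * f (x * u) * g u) * this
  have hu1 : ∀ u ∈ Ioi (0 : ℝ), (u : ℂ) ^ (1 - s) = u * (u : ℂ) ^ (1 - s - 1) := by
    intro u hu
    have hu' : (u : ℂ) ≠ 0 := by exact_mod_cast (ne_of_gt hu)
    rw [Complex.cpow_sub _ 1 hu', Complex.cpow_one]
    field_simp
  have hint : Integrable H (ν.prod ν) := by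
    rw [integrable_prod_iff hHm.aestronglyMeasurable]
    constructor
    · refine (ae_restrict_iff' measurableSet_Ioi).2 (ae_of_all _ fun u hu => ?_)
      have h1 : IntegrableOn (fun x => φ (x * u)) (Ioi 0) := by
        have := (integrableOn_Ioi_comp_mul_right_iff φ 0 hu).2 (by simpa using hφ)
        exact this
      exact (IntegrableOn.congr_fun (h1.mul_const ((u : ℂ) ^ (1 - s) * g u))
        (fun x hx => (hH u hu x hx).symm) measurableSet_Ioi)
    · have h2 : IntegrableOn (fun u : ℝ => ‖(u : ℂ) ^ (1 - s - 1) • g u‖ *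
          ∫ x in Ioi (0 : ℝ), ‖φ x‖) (Ioi 0) := Integrable.mul_const hg.norm _
      refine IntegrableOn.congr_fun h2 (fun u hu => ?_) measurableSet_Ioi
      have h3 : ∫ x in Ioi (0 : ℝ), ‖H (u, x)‖ =
          ∫ x in Ioi (0 : ℝ), ‖φ (x * u)‖ * ‖(u : ℂ) ^ (1 - s) * g u‖ :=
        setIntegral_congr_fun measurableSet_Ioi fun x hx => by rw [hH u hu x hx, norm_mul]
      have h4 := integral_comp_mul_right_Ioi (fun x => ‖φ x‖) 0 hu
      simp only [zero_mul] at h4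
      simp only [smul_eq_mul]
      rw [h3, integral_mul_const, h4, hu1 u hu, smul_eq_mul, norm_mul, norm_mul, norm_mul,
        Complex.norm_real, Real.norm_of_nonneg (le_of_lt hu)]
      have := ne_of_gt (show (0:ℝ) < u from hu)
      field_simp
  have hswap := hint.swap
  constructor
  · have := hswap.integral_prod_left
    refine this.congr (ae_of_all _ fun x => ?_)
    simp only [Function.comp, H, Prod.swap, smul_eq_mul]
    rw [integral_const_mul]
  · have e1 : mellin (fun x => ∫ u in Ioi (0 : ℝ), f (x * u) * g u) s =
        ∫ x, ∫ u, H (u, x) ∂ν ∂ν := by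
      unfold mellin
      refine integral_congr_ae (ae_of_all _ fun x => ?_)
      simp only [H, smul_eq_mul]
      rw [integral_const_mul]
    rw [e1, integral_integral_swap (f := fun x u => H (u, x)) hswap]
    have e2 : ∀ u ∈ Ioi (0 : ℝ), ∫ x, H (u, x) ∂ν =
        mellin f s * ((u : ℂ) ^ (1 - s - 1) • g u) := by
      intro u hu
      have h3 : ∫ x in Ioi (0 : ℝ), H (u, x) =
          ∫ x in Ioi (0 : ℝ), φ (x * u) * ((u : ℂ) ^ (1 - s) * g u) :=
        setIntegral_congr_fun measurableSet_Ioi fun x hx => hH u hu x hx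
      have h4 := integral_comp_mul_right_Ioi φ 0 hu
      simp only [zero_mul] at h4
      rw [hν, h3, integral_mul_const, h4, hu1 u hu]
      have : (u : ℂ) ≠ 0 := by exact_mod_cast (ne_of_gt hu)
      simp only [mellin, φ, smul_eq_mul, Complex.real_smul, Complex.ofReal_inv]
      field_simp
    rw [setIntegral_congr_fun measurableSet_Ioi e2, integral_const_mul]
    rfl

theorem HasMellin.congr_Ioi {f g : ℝ → ℂ} {s m : ℂ} (h : HasMellin f s m)
    (hfg : ∀ x, 0 < x → f x = g x) : HasMellin g s m := by
  have e : ∀ x ∈ Ioi (0 : ℝ), (x : ℂ) ^ (s - 1) • f x = (x : ℂ) ^ (s - 1) • g x :=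
    fun x hx => by rw [hfg x hx]
  exact ⟨IntegrableOn.congr_fun h.1 e measurableSet_Ioi,
    (setIntegral_congr_fun measurableSet_Ioi e).symm.trans h.2⟩

theorem HasMellin.comp_inv {f : ℝ → ℂ} {s m : ℂ} (h : HasMellin f (-s) m) :
    HasMellin (fun x => f x⁻¹) s m := by
  refine ⟨?_, (mellin_comp_inv f s).trans h.2⟩
  have := (MellinConvergent.comp_rpow (f := f) (s := s) (a := -1) (by norm_num)).2
    (by simpa [div_neg] using h.1)
  simpa [Real.rpow_neg_one] using this

theorem hasMellin_exp_neg {s : ℂ} (hs : 0 < s.re) :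
    HasMellin (fun x : ℝ => (Real.exp (-x) : ℂ)) s (Complex.Gamma s) := by
  refine ⟨?_, ?_⟩
  · have := Complex.GammaIntegral_convergent hs
    refine IntegrableOn.congr_fun this (fun x _ => ?_) measurableSet_Ioi
    simp [mul_comm]
  · rw [Complex.Gamma_eq_integral hs, Complex.GammaIntegral_eq_mellin]

/-- `1 / (1 + x) = ∫ exp (-x u) exp (-u) du` over the positive half-line. -/
theorem hasMellin_one_add_inv {s : ℂ} (hs : 0 < s.re) (hs1 : s.re < 1) :
    HasMellin (fun x : ℝ => (((1 + x)⁻¹ : ℝ) : ℂ)) s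
      (Complex.Gamma s * Complex.Gamma (1 - s)) := by
  have h1 := hasMellin_exp_neg hs
  have h2 := hasMellin_exp_neg (s := 1 - s) (by simpa using hs1)
  have hm : Measurable fun x : ℝ => (Real.exp (-x) : ℂ) := by fun_prop
  have h := hasMellin_multiplicativeConvolution hm hm h1.1 h2.1
  rw [h1.2, h2.2] at h
  refine h.congr_Ioi fun x hx => ?_
  have : ∀ u : ℝ, (Real.exp (-(x * u)) : ℂ) * (Real.exp (-u) : ℂ) =
      ((Real.exp (-(1 + x) * u) : ℝ) : ℂ) := fun u => by
    rw [← Complex.ofReal_mul, ← Real.exp_add]; congr 2; ring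
  simp_rw [this]
  rw [integral_complex_ofReal, integral_exp_mul_Ioi (by linarith)]
  congr 1
  simp only [mul_zero, Real.exp_zero]
  rw [neg_div_neg_eq, one_div]

/-- `log (1 + x) = ∫₀¹ x / (1 + x u) du` is the convolution of `x / (1 + x)` with `1 / t` cut off to
`(0, 1]`; the cut-off contributes the factor `1 / w`. The argument is `-w` because the logarithm
vanishes to first order at `0` and grows at infinity. -/
theorem hasMellin_log_one_add {w : ℂ} (hw : 0 < w.re) (hw1 : w.re < 1) :
    HasMellin (fun x : ℝ => (Real.log (1 + x) : ℂ)) (-w)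
      (Complex.Gamma w * Complex.Gamma (1 - w) / w) := by
  have h0 := hasMellin_one_add_inv (s := 1 - w) (by simpa using hw1) (by simpa using hw)
  have h1 : HasMellin (fun x : ℝ => (x : ℂ) ^ (1 : ℂ) • (((1 + x)⁻¹ : ℝ) : ℂ)) (-w)
      (Complex.Gamma (1 - w) * Complex.Gamma w) := by
    rw [sub_sub_cancel] at h0
    have e : -w + 1 = 1 - w := by ring
    refine ⟨MellinConvergent.cpow_smul.2 (by rw [e]; exact h0.1), ?_⟩
    rw [mellin_cpow_smul, e, h0.2]
  have h2 := hasMellin_cpow_Ioc (-1) (s := 1 - -w) (by simpa using hw)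
  have h := hasMellin_multiplicativeConvolution (by fun_prop)
    (Measurable.indicator (by fun_prop) measurableSet_Ioc) h1.1 h2.1
  rw [h1.2, h2.2] at h
  have e : Complex.Gamma (1 - w) * Complex.Gamma w * (1 / (1 - -w + -1)) =
      Complex.Gamma w * Complex.Gamma (1 - w) / w := by
    ring_nf
  rw [e] at h
  refine h.congr_Ioi fun x hx => ?_
  have e1 : ∀ u ∈ Ioi (0 : ℝ), ((x * u : ℝ) : ℂ) ^ (1 : ℂ) • (((1 + x * u)⁻¹ : ℝ) : ℂ) *
      (Ioc (0 : ℝ) 1).indicator (fun t : ℝ => (t : ℂ) ^ (-1 : ℂ)) u =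
      (Ioc (0 : ℝ) 1).indicator (fun t : ℝ => ((x / (1 + x * t) : ℝ) : ℂ)) u := by
    intro u hu
    by_cases hu1 : u ∈ Ioc (0 : ℝ) 1
    · have hu' : (u : ℂ) ≠ 0 := by exact_mod_cast (ne_of_gt hu)
      simp only [indicator_of_mem hu1, Complex.cpow_one, Complex.cpow_neg_one, smul_eq_mul]
      push_cast
      rw [div_eq_mul_inv]
      field_simp
    · simp [indicator_of_notMem hu1]
  rw [setIntegral_congr_fun measurableSet_Ioi e1, setIntegral_indicator measurableSet_Ioc,
    inter_eq_self_of_subset_right Ioc_subset_Ioi_self, integral_complex_ofReal,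
    ← intervalIntegral.integral_of_le zero_le_one]
  congr 1
  have hpos : ∀ t ∈ uIcc (0 : ℝ) 1, 0 < 1 + x * t := by
    intro t ht
    rw [uIcc_of_le zero_le_one] at ht
    have := mul_nonneg hx.le ht.1
    linarith
  rw [intervalIntegral.integral_eq_sub_of_hasDerivAt (f := fun t => Real.log (1 + x * t))]
  · simp
  · intro t ht
    have : HasDerivAt (fun t : ℝ => 1 + x * t) x t := by
      simpa using ((hasDerivAt_id t).const_mul x).const_add 1
    exact this.log (hpos t ht).ne'
  · refine ContinuousOn.intervalIntegrable ?_
    exact continuousOn_const.div (by fun_prop) fun t ht => (hpos t ht).ne'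

/-! ### The exponentially averaged logarithm and its Laplace transform. -/

/-- The mean of `log (1 + u / T)` for a standard exponential variable `T`. -/
noncomputable def expLogMean (u : ℝ) : ℝ :=
  ∫ t in Ioi (0 : ℝ), Real.exp (-t) * Real.log (1 + u / t)

theorem measurable_expLogMean : Measurable expLogMean := by
  have : StronglyMeasurable fun p : ℝ × ℝ => Real.exp (-p.2) * Real.log (1 + p.1 / p.2) :=
    Measurable.stronglyMeasurable (by fun_prop)
  exact (this.integral_prod_right (ν := volume.restrict (Ioi (0 : ℝ)))).measurable

/-- As a function of `1 / x` this is the convolution of `log (1 + 1 / y)` with `exp (-t)`, hence one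
inversion before and one after. -/
theorem hasMellin_expLogMean {w : ℂ} (hw : 0 < w.re) (hw1 : w.re < 1) :
    HasMellin (fun x : ℝ => (expLogMean x : ℂ)) (-w)
      (Complex.Gamma w * Complex.Gamma (1 - w) ^ 2 / w) := by
  have h1 := (hasMellin_log_one_add hw hw1).comp_inv
  have h2 := hasMellin_exp_neg (s := 1 - w) (by simpa using hw1)
  have h := hasMellin_multiplicativeConvolution (by fun_prop) (by fun_prop) h1.1 h2.1
  rw [h1.2, h2.2] at h
  rw [← neg_neg w] at h
  have h' := h.comp_inv
  simp only [neg_neg] at h'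
  have e : Complex.Gamma w * Complex.Gamma (1 - w) / w * Complex.Gamma (1 - w) =
    Complex.Gamma w * Complex.Gamma (1 - w) ^ 2 / w := by ring
  rw [e] at h'
  refine h'.congr_Ioi fun x hx => ?_
  rw [expLogMean, ← integral_complex_ofReal]
  refine setIntegral_congr_fun measurableSet_Ioi fun t ht => ?_
  simp only [mul_inv, inv_inv]
  push_cast
  rw [mul_comm, div_eq_mul_inv]

/-- The Laplace transform at `x` of `u ↦ u ^ (M - 1) * expLogMean u`. -/
noncomputable def laplaceExpLogMean (M : ℕ) (x : ℝ) : ℝ :=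
  ∫ u in Ioi (0 : ℝ), Real.exp (-(x * u)) * (u ^ (M - 1) * expLogMean u)

theorem hasMellin_pow_mul_expLogMean {M : ℕ} (hM : 1 ≤ M) {w : ℂ} (hw : 0 < w.re)
    (hw1 : w.re < 1) :
    HasMellin (fun x : ℝ => ((x ^ (M - 1) * expLogMean x : ℝ) : ℂ)) (1 - (M + w))
      (Complex.Gamma w * Complex.Gamma (1 - w) ^ 2 / w) := by
  have h := hasMellin_expLogMean hw hw1
  have e : 1 - (M + w) + ((M - 1 : ℕ) : ℂ) = -w := by push_cast [hM]; ring
  have h1 : HasMellin (fun x : ℝ => (x : ℂ) ^ ((M - 1 : ℕ) : ℂ) • (expLogMean x : ℂ))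
      (1 - (M + w)) (Complex.Gamma w * Complex.Gamma (1 - w) ^ 2 / w) := by
    refine ⟨MellinConvergent.cpow_smul.2 (by rw [e]; exact h.1), ?_⟩
    rw [mellin_cpow_smul, e, h.2]
  refine h1.congr_Ioi fun x hx => ?_
  rw [Complex.cpow_natCast]
  push_cast
  rfl

theorem hasMellin_laplaceExpLogMean {M : ℕ} (hM : 1 ≤ M) {w : ℂ} (hw : 0 < w.re)
    (hw1 : w.re < 1) :
    HasMellin (fun x : ℝ => (laplaceExpLogMean M x : ℂ)) (M + w)
      (Complex.Gamma (M + w) * (Complex.Gamma w * Complex.Gamma (1 - w) ^ 2 / w)) := by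
  have h1 := hasMellin_exp_neg (s := M + w)
    (by simp only [Complex.add_re, Complex.natCast_re]; positivity)
  have h2 := hasMellin_pow_mul_expLogMean hM hw hw1
  have hm := measurable_expLogMean
  have h := hasMellin_multiplicativeConvolution (by fun_prop) (by fun_prop) h1.1 h2.1
  rw [h1.2, h2.2] at h
  refine h.congr_Ioi fun x hx => ?_
  rw [laplaceExpLogMean, ← integral_complex_ofReal]
  simp only [Complex.ofReal_mul]

/-! ### Mellin inversion and the Meijer G-function. -/

/-- Raise `y ≤ exp y` at `y = a u / σ` to the power `σ`. The bound dominates a Laplace integrand by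
a Mellin integrand, uniformly in `x ≥ a`, so Mellin convergence gives continuity and integrability.
-/
theorem exp_neg_mul_le_rpow {σ a x u : ℝ} (hσ : 0 < σ) (ha : 0 < a) (hx : a ≤ x) (hu : 0 < u) :
    Real.exp (-(x * u)) ≤ (σ / a) ^ σ * u ^ (-σ) := by
  have h1 : a * u / σ ≤ Real.exp (a * u / σ) := by
    linarith [Real.add_one_le_exp (a * u / σ)]
  have h2 : (a * u / σ) ^ σ ≤ Real.exp (a * u) := by
    have := Real.rpow_le_rpow (by positivity) h1 hσ.le
    rwa [← Real.exp_mul, div_mul_cancel₀ _ hσ.ne'] at this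
  have h3 : Real.exp (-(x * u)) ≤ Real.exp (-(a * u)) :=
    Real.exp_le_exp.2 (by nlinarith)
  refine h3.trans ?_
  rw [Real.exp_neg, Real.rpow_neg hu.le, ← div_eq_mul_inv, ← Real.div_rpow (by positivity) hu.le,
    ← inv_inv (σ / a / u), Real.inv_rpow (by positivity)]
  refine inv_anti₀ (by positivity) ?_
  have e : (σ / a / u)⁻¹ = a * u / σ := by rw [div_div, inv_div]
  rwa [e]

theorem continuousAt_integral_exp_neg_mul {g : ℝ → ℂ} (hg : Measurable g) {σ : ℝ} (hσ : 0 < σ)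
    (hc : MellinConvergent g (1 - σ)) {x : ℝ} (hx : 0 < x) :
    ContinuousAt (fun x : ℝ => ∫ u in Ioi (0 : ℝ), (Real.exp (-(x * u)) : ℂ) * g u) x := by
  have hn := hc.norm
  refine continuousAt_of_dominated
    (bound := fun u => (σ / (x / 2)) ^ σ * ‖(u : ℂ) ^ ((1 - σ - 1 : ℂ)) • g u‖) ?_ ?_ ?_ ?_
  · exact Filter.Eventually.of_forall fun y => by
      have : Measurable fun u : ℝ => (Real.exp (-(y * u)) : ℂ) := by fun_prop
      exact (this.mul hg).aestronglyMeasurable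
  · filter_upwards [lt_mem_nhds (half_lt_self hx)] with y hy
    refine (ae_restrict_iff' measurableSet_Ioi).2 (ae_of_all _ fun u hu => ?_)
    have e : (1 - σ - 1 : ℂ) = ((-σ : ℝ) : ℂ) := by push_cast; ring
    rw [norm_mul, norm_smul, Complex.norm_real, Real.norm_of_nonneg (Real.exp_nonneg _), e,
      Complex.norm_cpow_eq_rpow_re_of_pos hu, Complex.ofReal_re, ← mul_assoc]
    exact mul_le_mul_of_nonneg_right (exp_neg_mul_le_rpow hσ (half_pos hx) hy.le hu) (norm_nonneg _)
  · exact hn.const_mul _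
  · exact ae_of_all _ fun u => by fun_prop

theorem continuousAt_laplaceExpLogMean {M : ℕ} (hM : 1 ≤ M) {x : ℝ} (hx : 0 < x) :
    ContinuousAt (fun x : ℝ => (laplaceExpLogMean M x : ℂ)) x := by
  have h := hasMellin_pow_mul_expLogMean hM (w := ((1 / 2 : ℝ) : ℂ))
    (by rw [Complex.ofReal_re]; norm_num) (by rw [Complex.ofReal_re]; norm_num)
  have hm := measurable_expLogMean
  have h2 := continuousAt_integral_exp_neg_mul
    (g := fun x : ℝ => ((x ^ (M - 1) * expLogMean x : ℝ) : ℂ)) (by fun_prop) (σ := M + 1 / 2) (by positivity)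
    (by simpa using h.1) hx
  convert h2 using 2 with y
  rw [laplaceExpLogMean, ← integral_complex_ofReal]
  simp only [Complex.ofReal_mul]

theorem norm_Gamma_le_Gamma_re {s : ℂ} (hs : 0 < s.re) :
    ‖Complex.Gamma s‖ ≤ Real.Gamma s.re := by
  rw [Complex.Gamma_eq_integral hs, Complex.GammaIntegral, Real.Gamma_eq_integral hs]
  refine (norm_integral_le_integral_norm _).trans (le_of_eq ?_)
  refine setIntegral_congr_fun measurableSet_Ioi fun x hx => ?_
  rw [norm_mul, Complex.norm_cpow_eq_rpow_re_of_pos hx, Complex.norm_real,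
    Real.norm_of_nonneg (Real.exp_nonneg _)]
  simp

/-- Quadratic decay suffices: `Γ(w) = Γ(w + 1) / w` exposes a factor `1 / w²`, and the remaining
Gamma factors are bounded on the line by their values at the real part. -/
theorem integrable_Gamma_product {M : ℕ} {c : ℝ} (hc : 0 < c) (hc1 : c < 1) :
    Integrable fun y : ℝ => Complex.Gamma (M + (c + y * I)) * (Complex.Gamma (c + y * I) *
      Complex.Gamma (1 - (c + y * I)) ^ 2 / (c + y * I)) := by
  have hre : ∀ y : ℝ, (c + y * I : ℂ).re = c := fun y => by simp
  have hne : ∀ y : ℝ, (c + y * I : ℂ) ≠ 0 := fun y h => by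
    have := hre y; rw [h] at this; simp at this; linarith
  have hline : ∀ d e : ℝ, 0 < d → Continuous fun y : ℝ => Complex.Gamma (d + e * (y * I)) := by
    intro d e hd
    refine continuous_iff_continuousAt.2 fun y => ?_
    refine ContinuousAt.comp (g := Complex.Gamma) ?_ (by fun_prop)
    refine (Complex.differentiableAt_Gamma _ fun m h => ?_).continuousAt
    have := congrArg Complex.re h
    simp at this
    have hm : (0 : ℝ) ≤ m := m.cast_nonneg
    linarith
  have hcont : Continuous fun y : ℝ => Complex.Gamma (M + (c + y * I)) *
      (Complex.Gamma (c + y * I) * Complex.Gamma (1 - (c + y * I)) ^ 2 / (c + y * I)) := by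
    have h1 := hline (M + c) 1 (by positivity)
    have h2 := hline c 1 hc
    have h3 := hline (1 - c) (-1) (by linarith)
    have e1 : (fun y : ℝ => Complex.Gamma (M + (c + y * I))) =
      fun y : ℝ => Complex.Gamma (((M + c : ℝ) : ℂ) + ((1 : ℝ) : ℂ) * (y * I)) := by
        funext y; congr 1; push_cast; ring
    have e2 : (fun y : ℝ => Complex.Gamma (c + y * I)) =
      fun y : ℝ => Complex.Gamma ((c : ℂ) + ((1 : ℝ) : ℂ) * (y * I)) := by
        funext y; congr 1; push_cast; ring
    have e3 : (fun y : ℝ => Complex.Gamma (1 - (c + y * I))) =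
      fun y : ℝ => Complex.Gamma (((1 - c : ℝ) : ℂ) + ((-1 : ℝ) : ℂ) * (y * I)) := by
        funext y; congr 1; push_cast; ring
    rw [← e1] at h1
    rw [← e2] at h2
    rw [← e3] at h3
    exact h1.mul ((h2.mul (h3.pow 2)).div (by fun_prop) hne)
  set K := Real.Gamma (M + c) * (Real.Gamma (c + 1) * Real.Gamma (1 - c) ^ 2 * (c ^ 2)⁻¹) with hK
  have hdom : Integrable fun y : ℝ => K * (1 + y ^ 2)⁻¹ := integrable_inv_one_add_sq.const_mul K
  refine hdom.mono' hcont.aestronglyMeasurable (ae_of_all _ fun y => ?_)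
  set w : ℂ := c + y * I with hw
  have hwre : w.re = c := hre y
  have hG1 : ‖Complex.Gamma (M + w)‖ ≤ Real.Gamma (M + c) := by
    have := norm_Gamma_le_Gamma_re (s := M + w) (by simp only [Complex.add_re, Complex.natCast_re, hwre]; positivity)
    simpa [hwre] using this
  have hG2 : ‖Complex.Gamma (1 - w)‖ ≤ Real.Gamma (1 - c) := by
    have := norm_Gamma_le_Gamma_re (s := 1 - w) (by simp [hwre]; linarith)
    simpa [hwre] using this
  have hG3 : ‖Complex.Gamma (w + 1)‖ ≤ Real.Gamma (c + 1) := by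
    have := norm_Gamma_le_Gamma_re (s := w + 1) (by simp [hwre]; linarith)
    simpa [hwre] using this
  -- Here `‖w‖² = c² + y²`, and `c < 1` is what gives the inequality.
  have hw2 : c ^ 2 * (1 + y ^ 2) ≤ ‖w‖ ^ 2 := by
    rw [Complex.sq_norm, Complex.normSq_apply, hwre]
    have : w.im = y := by simp [hw]
    rw [this]
    nlinarith [sq_nonneg y, mul_pos hc hc, mul_nonneg (sq_nonneg y) (by nlinarith : (0:ℝ) ≤ 1 - c ^ 2)]
  have e : Complex.Gamma (M + w) * (Complex.Gamma w * Complex.Gamma (1 - w) ^ 2 / w) =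
      Complex.Gamma (M + w) * (Complex.Gamma (w + 1) * Complex.Gamma (1 - w) ^ 2 * (w ^ 2)⁻¹) := by
    rw [Complex.Gamma_add_one w (hne y)]
    have := hne y
    rw [← hw] at this
    field_simp
  rw [e]
  simp only [norm_mul, norm_pow, norm_inv]
  have hinv : (‖w‖ ^ 2)⁻¹ ≤ (c ^ 2)⁻¹ * (1 + y ^ 2)⁻¹ := by
    rw [← mul_inv]; exact inv_anti₀ (by positivity) hw2
  have p1 := Real.Gamma_pos_of_pos (show 0 < 1 - c by linarith)
  have p2 := Real.Gamma_pos_of_pos (show 0 < c + 1 by linarith)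
  have p3 := Real.Gamma_pos_of_pos (show 0 < M + c by positivity)
  calc _ ≤ Real.Gamma (M + c) * (Real.Gamma (c + 1) * Real.Gamma (1 - c) ^ 2 *
        ((c ^ 2)⁻¹ * (1 + y ^ 2)⁻¹)) := by gcongr
    _ = K * (1 + y ^ 2)⁻¹ := by rw [hK]; ring

/-- The lower parameters give `Γ(M + w) Γ(w)²`, the upper ones `Γ(1 - w)²` and the denominator `Γ(1
+ w) = w Γ(w)`, which cancels one `Γ(w)`. -/
theorem meijerIntegrand_params_eq (M : ℕ) {x : ℝ} {w : ℂ} (hw : w ≠ 0) :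
    meijerIntegrand 3 2 (upperParams M) (lowerParams M) x (-(M + w)) =
      (x : ℂ) ^ (-(M + w)) *
        (Complex.Gamma (M + w) * (Complex.Gamma w * Complex.Gamma (1 - w) ^ 2 / w)) := by
  have f3 : Finset.univ.filter (fun j : Fin 3 => (j : ℕ) < 3) = {0, 1, 2} := by decide
  have f2 : Finset.univ.filter (fun j : Fin 3 => (j : ℕ) < 2) = {0, 1} := by decide
  have g3 : Finset.univ.filter (fun j : Fin 3 => 3 ≤ (j : ℕ)) = ∅ := by decide
  have g2 : Finset.univ.filter (fun j : Fin 3 => 2 ≤ (j : ℕ)) = {2} := by decide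
  have hG : Complex.Gamma (1 - M - -(M + w)) = w * Complex.Gamma w := by
    rw [← Complex.Gamma_add_one w hw]; congr 1; ring
  rw [meijerIntegrand, f3, f2, g3, g2]
  simp [upperParams, lowerParams]
  have e1 : (1 + M + (-w + -M) : ℂ) = 1 - w := by ring
  have e2 : (1 - M - (-w + -M) : ℂ) = 1 - M - -(M + w) := by ring
  rw [e1, e2, hG]
  -- The cancelled factor can be zero only through the default value of `Γ` at its poles; both sides
  -- then vanish.
  by_cases h0 : Complex.Gamma w = 0
  · simp [h0]
  · field_simp

theorem separatesPoles_params_iff (M : ℕ) (c : ℝ) :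
    SeparatesPoles 3 2 (upperParams M) (lowerParams M) c ↔ -(M : ℝ) - 1 < c ∧ c < -M := by
  simp [SeparatesPoles, upperParams, lowerParams, Fin.forall_fin_succ]
  have hM : (0 : ℝ) ≤ M := M.cast_nonneg
  constructor
  · rintro ⟨⟨_, h⟩, h'⟩
    exact ⟨h', h⟩
  · rintro ⟨h', h⟩
    exact ⟨⟨by linarith, h⟩, h'⟩

/-- Mellin inversion along `Re = M + d` with `d = -M - c`; the separating lines are exactly those
with `0 < d < 1`. -/
theorem meijerLineIntegral_params {M : ℕ} (hM : 1 ≤ M) {x c : ℝ} (hx : 0 < x)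
    (hc : -(M : ℝ) - 1 < c) (hc1 : c < -M) :
    Integrable (fun y : ℝ => meijerIntegrand 3 2 (upperParams M) (lowerParams M) x (c + y * I)) ∧
    meijerLineIntegral 3 2 (upperParams M) (lowerParams M) x c = laplaceExpLogMean M x := by
  set d : ℝ := -M - c with hd
  have hd0 : 0 < d := by linarith
  have hd1 : d < 1 := by linarith
  have hne : ∀ y : ℝ, (d + y * I : ℂ) ≠ 0 := fun y h => by
    have := congrArg Complex.re h; simp at this; linarith
  have hmel : ∀ y : ℝ, mellin (fun x : ℝ => (laplaceExpLogMean M x : ℂ)) (((M + d : ℝ) : ℂ) + y * I) =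
      Complex.Gamma (M + (d + y * I)) * (Complex.Gamma (d + y * I) *
        Complex.Gamma (1 - (d + y * I)) ^ 2 / (d + y * I)) := fun y => by
    have := (hasMellin_laplaceExpLogMean hM (w := d + y * I) (by simpa using hd0) (by simpa using hd1)).2
    rw [← this]; congr 1; push_cast; ring
  have hvert : Complex.VerticalIntegrable (mellin fun x : ℝ => (laplaceExpLogMean M x : ℂ)) (M + d) := by
    unfold Complex.VerticalIntegrable
    simp_rw [hmel]
    exact integrable_Gamma_product hd0 hd1
  have hconv : MellinConvergent (fun x : ℝ => (laplaceExpLogMean M x : ℂ)) ((M + d : ℝ) : ℂ) := by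
    have := (hasMellin_laplaceExpLogMean hM (w := d) (by simpa using hd0) (by simpa using hd1)).1
    simpa using this
  have hinv := mellinInv_mellin_eq (M + d) _ hx hconv hvert (continuousAt_laplaceExpLogMean hM hx)
  -- The change `s = -(M + w)` reverses the line, hence `-y`; integrals over the whole line do not
  -- see this.
  have hint : ∀ y : ℝ, (x : ℂ) ^ (-(((M + d : ℝ) : ℂ) + y * I)) •
      mellin (fun x : ℝ => (laplaceExpLogMean M x : ℂ)) (((M + d : ℝ) : ℂ) + y * I) =
      meijerIntegrand 3 2 (upperParams M) (lowerParams M) x (c + ((-y : ℝ) : ℂ) * I) := by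
    intro y
    have e : (c + ((-y : ℝ) : ℂ) * I : ℂ) = -(M + (d + y * I)) := by
      rw [hd]; push_cast; ring
    rw [e, meijerIntegrand_params_eq M (hne y), hmel, smul_eq_mul]
    congr 2; push_cast; ring
  constructor
  · have h1 : Integrable fun y : ℝ => (x : ℂ) ^ (-(((M + d : ℝ) : ℂ) + y * I)) •
        mellin (fun x : ℝ => (laplaceExpLogMean M x : ℂ)) (((M + d : ℝ) : ℂ) + y * I) := by
      have hx' : (x : ℂ) ≠ 0 := by exact_mod_cast hx.ne'
      refine Integrable.bdd_mul (c := x ^ (-(M + d))) hvert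
        (Continuous.const_cpow (by fun_prop) (Or.inl hx')).aestronglyMeasurable
        (ae_of_all _ fun y => ?_)
      rw [Complex.norm_cpow_eq_rpow_re_of_pos hx]
      simp
    simp_rw [hint] at h1
    simpa using h1.comp_neg
  · rw [← hinv, mellinInv, meijerLineIntegral]
    simp_rw [hint]
    rw [integral_neg_eq_self (fun y : ℝ => meijerIntegrand 3 2 (upperParams M) (lowerParams M) x (c + y * I))]
    simp

theorem hasMeijerG_rateG {M : ℕ} (hM : 1 ≤ M) {x : ℝ} (hx : 0 < x) :
    rateG M x = laplaceExpLogMean M x ∧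
    HasMeijerG 3 2 (upperParams M) (lowerParams M) (x : ℂ) (rateG M x) := by
  have hex : ∃ c : ℝ, SeparatesPoles 3 2 (upperParams M) (lowerParams M) c :=
    ⟨-M - 1 / 2, (separatesPoles_params_iff _ _).2 ⟨by linarith, by linarith⟩⟩
  have hall : ∀ c : ℝ, SeparatesPoles 3 2 (upperParams M) (lowerParams M) c → _ := fun c hc =>
    meijerLineIntegral_params hM hx ((separatesPoles_params_iff _ _).1 hc).1
      ((separatesPoles_params_iff _ _).1 hc).2
  have e : rateG M x = laplaceExpLogMean M x := by
    rw [rateG, meijerG, dif_pos hex]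
    exact (hall _ hex.choose_spec).2
  exact ⟨e, hex, by rw [e]; exact hall⟩

/-! ### Erlang laws of the channel gains, by characteristic functions. -/

theorem integrableOn_pow_mul_exp_neg_mul (n : ℕ) {b : ℝ} (hb : 0 < b) :
    IntegrableOn (fun x : ℝ => x ^ n * Real.exp (-(b * x))) (Ioi 0) := by
  have h := integrableOn_rpow_mul_exp_neg_mul_rpow (s := n) (p := 1)
    (by have : (0 : ℝ) ≤ n := n.cast_nonneg
        linarith) one_pos hb
  refine h.congr_fun (fun x hx => ?_) measurableSet_Ioi
  simp

theorem integrableOn_pow_mul_cexp_neg_mul (n : ℕ) {b : ℂ} (hb : 0 < b.re) :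
    IntegrableOn (fun x : ℝ => (x : ℂ) ^ n * Complex.exp (-(b * x))) (Ioi 0) := by
  have h := integrableOn_pow_mul_exp_neg_mul n hb
  refine Integrable.mono h (by fun_prop) ?_
  refine (ae_restrict_iff' measurableSet_Ioi).2 (ae_of_all _ fun x hx => ?_)
  simp [Complex.norm_exp]

/-- Induction by parts. The rate is complex because the Erlang characteristic function needs `b = r
- t * I`. -/
theorem integral_pow_mul_cexp_neg_mul (n : ℕ) {b : ℂ} (hb : 0 < b.re) :
    ∫ x in Ioi (0 : ℝ), (x : ℂ) ^ n * Complex.exp (-(b * x)) = n.factorial / b ^ (n + 1) := by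
  have hb0 : b ≠ 0 := by rintro rfl; simp at hb
  have hexp : ∀ x : ℝ, HasDerivAt (fun x : ℝ => Complex.exp (-(b * x)))
      (Complex.exp (-(b * x)) * (-b)) x := fun x => by
    have h1 : HasDerivAt (fun x : ℝ => -(b * (x : ℂ))) (-b) x := by
      simpa using (((hasDerivAt_id x).ofReal_comp).const_mul b).fun_neg
    exact h1.cexp
  have htend : ∀ n : ℕ, Filter.Tendsto (fun x : ℝ => (x : ℂ) ^ n * Complex.exp (-(b * x)))
      Filter.atTop (nhds 0) := fun n => by
    rw [tendsto_zero_iff_norm_tendsto_zero]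
    have h := tendsto_rpow_mul_exp_neg_mul_atTop_nhds_zero n b.re hb
    refine h.congr' ?_
    filter_upwards [Filter.eventually_gt_atTop 0] with x hx
    simp [Complex.norm_exp, abs_of_pos hx]
  induction n with
  | zero =>
    have hderiv : ∀ x ∈ Ici (0 : ℝ), HasDerivAt (fun x : ℝ => Complex.exp (-(b * x)) * (-b)⁻¹)
        ((x : ℂ) ^ 0 * Complex.exp (-(b * x))) x := fun x _ => by
      have := (hexp x).mul_const (-b)⁻¹
      rwa [mul_assoc, mul_inv_cancel₀ (neg_ne_zero.2 hb0), mul_one, ← one_mul (Complex.exp _),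
        ← pow_zero (x : ℂ)] at this
    have ht := (htend 0).mul_const (-b)⁻¹
    simp only [pow_zero, one_mul, zero_mul] at ht
    rw [integral_Ioi_of_hasDerivAt_of_tendsto' hderiv
      (integrableOn_pow_mul_cexp_neg_mul 0 hb) ht]
    simp [inv_neg]
  | succ n ih =>
    have hderiv : ∀ x ∈ Ici (0 : ℝ), HasDerivAt (fun x : ℝ => (x : ℂ) ^ (n + 1) * Complex.exp (-(b * x)))
        ((n + 1 : ℂ) * ((x : ℂ) ^ n * Complex.exp (-(b * x))) -
          b * ((x : ℂ) ^ (n + 1) * Complex.exp (-(b * x)))) x := fun x _ => by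
      have h1 : HasDerivAt (fun x : ℝ => (x : ℂ) ^ (n + 1)) ((n + 1 : ℂ) * (x : ℂ) ^ n) x := by
        simpa using ((hasDerivAt_id x).ofReal_comp).fun_pow (n + 1)
      exact (h1.fun_mul (hexp x)).congr_deriv (by ring)
    have i1 := (integrableOn_pow_mul_cexp_neg_mul n hb).const_mul (n + 1 : ℂ)
    have i2 := (integrableOn_pow_mul_cexp_neg_mul (n + 1) hb).const_mul b
    have h := integral_Ioi_of_hasDerivAt_of_tendsto' hderiv (i1.sub i2) (htend (n + 1))
    rw [integral_sub i1 i2, integral_const_mul, integral_const_mul, ih] at h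
    have h2 : b * ∫ x in Ioi (0 : ℝ), (x : ℂ) ^ (n + 1) * Complex.exp (-(b * x)) =
        (n + 1) * (n.factorial / b ^ (n + 1)) := by
      simp at h
      linear_combination -h
    rw [eq_div_iff (pow_ne_zero _ hb0), pow_succ b (n + 1), mul_comm (b ^ (n + 1)) b, ← mul_assoc,
      mul_comm _ b, h2, Nat.factorial_succ]
    push_cast
    field_simp

/-- The Erlang density of shape `N` and rate `r` on the positive half-line. -/
noncomputable def erlangPDF (N : ℕ) (r x : ℝ) : ℝ :=
  r ^ N / Real.Gamma N * (x ^ (N - 1) * Real.exp (-(r * x)))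

/-- The Erlang distribution of shape `N` and rate `r`. -/
noncomputable def erlangMeasure (N : ℕ) (r : ℝ) : Measure ℝ :=
  (volume.restrict (Ioi 0)).withDensity fun x => ENNReal.ofReal (erlangPDF N r x)

theorem measurable_erlangPDF (N : ℕ) (r : ℝ) : Measurable (erlangPDF N r) := by
  unfold erlangPDF; fun_prop

theorem erlangPDF_nonneg {N : ℕ} {r x : ℝ} (hr : 0 < r) (hx : 0 < x) : 0 ≤ erlangPDF N r x := by
  have := Real.Gamma_nonneg_of_nonneg (Nat.cast_nonneg (α := ℝ) N)
  unfold erlangPDF; positivity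

theorem integrableOn_erlangPDF (N : ℕ) {r : ℝ} (hr : 0 < r) :
    IntegrableOn (erlangPDF N r) (Ioi 0) :=
  (integrableOn_pow_mul_exp_neg_mul _ hr).const_mul _

theorem isFiniteMeasure_erlangMeasure (N : ℕ) {r : ℝ} (hr : 0 < r) :
    IsFiniteMeasure (erlangMeasure N r) :=
  isFiniteMeasure_withDensity_ofReal (integrableOn_erlangPDF N hr).2

theorem integral_erlangMeasure {E : Type*} [NormedAddCommGroup E] [NormedSpace ℝ E] (N : ℕ) {r : ℝ}
    (hr : 0 < r) (f : ℝ → E) :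
    ∫ x, f x ∂(erlangMeasure N r) = ∫ x in Ioi (0 : ℝ), erlangPDF N r x • f x := by
  rw [erlangMeasure, integral_withDensity_eq_integral_toReal_smul
    (measurable_erlangPDF N r).ennreal_ofReal (ae_of_all _ fun x => ENNReal.ofReal_lt_top)]
  refine setIntegral_congr_fun measurableSet_Ioi fun x hx => ?_
  simp only [ENNReal.toReal_ofReal (erlangPDF_nonneg hr hx)]

theorem charFun_erlangMeasure {N : ℕ} (hN : 1 ≤ N) {r : ℝ} (hr : 0 < r) (t : ℝ) :
    charFun (erlangMeasure N r) t = (r / (r - t * I)) ^ N := by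
  obtain ⟨n, rfl⟩ : ∃ n, N = n + 1 := ⟨N - 1, by omega⟩
  have hre : 0 < (r - t * I : ℂ).re := by simpa using hr
  rw [charFun_apply_real, integral_erlangMeasure _ hr]
  have e : ∀ x : ℝ, erlangPDF (n + 1) r x • Complex.exp (t * x * I) =
      ((r ^ (n + 1) / n.factorial : ℝ) : ℂ) * ((x : ℂ) ^ n * Complex.exp (-((r - t * I) * x))) := by
    intro x
    have h1 : Complex.exp (-((r - t * I) * x)) =
        Complex.exp (((-(r * x) : ℝ) : ℂ)) * Complex.exp (t * x * I) := by
      rw [← Complex.exp_add]; congr 1; push_cast; ring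
    rw [h1, erlangPDF, Complex.real_smul]
    have := Real.Gamma_nat_eq_factorial n
    push_cast at this ⊢
    rw [this, Complex.ofReal_natCast]
    ring
  simp_rw [e]
  rw [integral_const_mul, integral_pow_mul_cexp_neg_mul n hre, div_pow]
  have : (n.factorial : ℂ) ≠ 0 := by exact_mod_cast n.factorial_ne_zero
  push_cast
  field_simp

/-- Real and imaginary parts contribute the same complex Gaussian integral, so only its square
occurs and no branch of the square root has to be chosen. -/
theorem charFun_normSq_circularGaussian {v : ℝ} (hv : 0 < v) (t : ℝ) :
    charFun ((circularGaussian v).map fun z => ‖z‖ ^ 2) t =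
      (v⁻¹ : ℝ) / ((v⁻¹ : ℝ) - t * I) := by
  have hm : Measurable fun r : ℝ × ℝ => (r.1 : ℂ) + (r.2 : ℂ) * I := by fun_prop
  have hv2 : (v / 2).toNNReal ≠ 0 := by simpa using hv
  rw [charFun_apply_real, integral_map (by fun_prop) (by fun_prop), circularGaussian,
    integral_map hm.aemeasurable (by fun_prop)]
  have e : ∀ p : ℝ × ℝ, Complex.exp (t * ((‖(p.1 : ℂ) + (p.2 : ℂ) * I‖ ^ 2 : ℝ) : ℂ) * I) =
      Complex.exp (t * p.1 ^ 2 * I) * Complex.exp (t * p.2 ^ 2 * I) := by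
    intro p
    rw [← Complex.exp_add, Complex.sq_norm, Complex.normSq_add_mul_I]
    congr 1; push_cast; ring
  simp_rw [e]
  rw [integral_prod_mul (f := fun x : ℝ => Complex.exp (t * (x : ℂ) ^ 2 * I))
    (g := fun x : ℝ => Complex.exp (t * (x : ℂ) ^ 2 * I)), ← sq,
    integral_gaussianReal_eq_integral_smul hv2]
  have e2 : ∀ x : ℝ, gaussianPDFReal 0 (v / 2).toNNReal x • Complex.exp (t * (x : ℂ) ^ 2 * I) =
      (((√(Real.pi * v))⁻¹ : ℝ) : ℂ) * Complex.exp (-((v⁻¹ : ℝ) - t * I) * (x : ℂ) ^ 2) := by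
    intro x
    have h1 : Complex.exp (-((v⁻¹ : ℝ) - t * I) * (x : ℂ) ^ 2) =
        Complex.exp ((-(x ^ 2 / v) : ℝ) : ℂ) * Complex.exp (t * (x : ℂ) ^ 2 * I) := by
      rw [← Complex.exp_add]; congr 1; push_cast; ring
    rw [h1, gaussianPDFReal, Complex.real_smul, Real.coe_toNNReal _ (by positivity), sub_zero,
      show 2 * Real.pi * (v / 2) = Real.pi * v by ring, show 2 * (v / 2) = v by ring, neg_div]
    push_cast
    ring
  simp_rw [e2]
  have hre : 0 < (((v⁻¹ : ℝ) : ℂ) - t * I).re := by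
    simpa using hv
  rw [integral_const_mul, mul_pow, integral_gaussian_sq_complex hre, ← Complex.ofReal_pow, inv_pow,
    Real.sq_sqrt (by positivity)]
  have hpi : (Real.pi : ℂ) ≠ 0 := by exact_mod_cast Real.pi_ne_zero
  push_cast
  field_simp


theorem hasLaw_mrcGain [MeasurableSpace S] {μ : Measure S} [IsProbabilityMeasure μ] {N : ℕ}
    (hN : 1 ≤ N) {v : ℝ} (hv : 0 < v) {h : Fin N → S → ℂ}
    (hlaw : ∀ i, HasLaw (h i) (circularGaussian v) μ) (hind : iIndepFun h μ) :
    HasLaw (mrcGain h) (erlangMeasure N v⁻¹) μ := by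
  have hmeas : ∀ i, AEMeasurable (fun ω => ‖h i ω‖ ^ 2) μ := fun i =>
    (hlaw i).aemeasurable.norm.pow_const 2
  have haem : AEMeasurable (mrcGain h) μ := by
    unfold mrcGain
    exact Finset.aemeasurable_fun_sum _ fun i _ => hmeas i
  refine ⟨haem, ?_⟩
  have := isFiniteMeasure_erlangMeasure N (inv_pos.2 hv)
  have := Measure.isProbabilityMeasure_map (μ := μ) haem
  refine Measure.ext_of_charFun (funext fun t => ?_)
  have hind2 : iIndepFun (fun i ω => ‖h i ω‖ ^ 2) μ :=
    hind.comp (fun _ z => ‖z‖ ^ 2) fun _ => by fun_prop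
  have e := hind2.charFun_map_fun_sum_eq_prod hmeas
  rw [show mrcGain h = fun ω => ∑ i, ‖h i ω‖ ^ 2 from rfl, e, charFun_erlangMeasure hN (inv_pos.2 hv),
    Finset.prod_apply]
  have e2 : ∀ i, charFun (μ.map fun ω => ‖h i ω‖ ^ 2) t =
      (v⁻¹ : ℝ) / ((v⁻¹ : ℝ) - t * I) := by
    intro i
    rw [← charFun_normSq_circularGaussian hv, ← (hlaw i).map_eq,
      AEMeasurable.map_map_of_aemeasurable (by fun_prop) (hlaw i).aemeasurable]
    rfl
  simp only [e2, Finset.prod_const, Finset.card_univ, Fintype.card_fin]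

/-! ### The minimum of two independent Erlang variables. -/

/-- Split according to which coordinate is the minimum. Ties go to the first, hence `Ici` in one
term and `Ioi` in the other; `ν` may have atoms. -/
theorem map_min_prod_withDensity {ν : Measure ℝ} [SFinite ν] {f g : ℝ → ENNReal}
    (hf : Measurable f) (hg : Measurable g) [SFinite (ν.withDensity f)] [SFinite (ν.withDensity g)] :
    ((ν.withDensity f).prod (ν.withDensity g)).map (fun p => min p.1 p.2) =
      ν.withDensity fun x => f x * ν.withDensity g (Ici x) + g x * ν.withDensity f (Ioi x) := by
  have hmI : Measurable fun x => ν.withDensity g (Ici x) :=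
    Antitone.measurable fun x y h => measure_mono (Ici_subset_Ici.2 h)
  have hmO : Measurable fun x => ν.withDensity f (Ioi x) :=
    Antitone.measurable fun x y h => measure_mono (Ioi_subset_Ioi h)
  refine Measure.ext fun s hs => ?_
  have hA : MeasurableSet {p : ℝ × ℝ | p.1 ∈ s ∧ p.1 ≤ p.2} :=
    (measurable_fst hs).inter (measurableSet_le measurable_fst measurable_snd)
  have hB : MeasurableSet {p : ℝ × ℝ | p.2 ∈ s ∧ p.2 < p.1} :=
    (measurable_snd hs).inter (measurableSet_lt measurable_snd measurable_fst)
  have hAB : (fun p : ℝ × ℝ => min p.1 p.2) ⁻¹' s =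
      {p : ℝ × ℝ | p.1 ∈ s ∧ p.1 ≤ p.2} ∪ {p : ℝ × ℝ | p.2 ∈ s ∧ p.2 < p.1} := by
    ext ⟨x, y⟩
    rcases le_or_gt x y with h | h
    · simp [h, h.not_gt]
    · simp [h, h.not_ge, h.le]
  have hdisj : Disjoint {p : ℝ × ℝ | p.1 ∈ s ∧ p.1 ≤ p.2} {p : ℝ × ℝ | p.2 ∈ s ∧ p.2 < p.1} :=
    Set.disjoint_left.2 fun p h1 h2 => h2.2.not_ge h1.2
  have e1 : ∀ x, ν.withDensity g (Prod.mk x ⁻¹' {p : ℝ × ℝ | p.1 ∈ s ∧ p.1 ≤ p.2}) =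
      s.indicator (fun x => ν.withDensity g (Ici x)) x := fun x => by
    by_cases hx : x ∈ s
    · rw [indicator_of_mem hx]; congr 1; ext y; simp [hx]
    · rw [indicator_of_notMem hx, ← measure_empty (μ := ν.withDensity g)]; congr 1; ext y; simp [hx]
  have e2 : ∀ y, ν.withDensity f ((fun x => (x, y)) ⁻¹' {p : ℝ × ℝ | p.2 ∈ s ∧ p.2 < p.1}) =
      s.indicator (fun x => ν.withDensity f (Ioi x)) y := fun x => by
    by_cases hx : x ∈ s
    · rw [indicator_of_mem hx]; congr 1; ext y; simp [hx]
    · rw [indicator_of_notMem hx, ← measure_empty (μ := ν.withDensity f)]; congr 1; ext y; simp [hx]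
  rw [Measure.map_apply (by fun_prop) hs, hAB, measure_union hdisj hB, Measure.prod_apply hA,
    Measure.prod_apply_symm hB]
  simp_rw [e1, e2]
  rw [lintegral_indicator hs, lintegral_indicator hs,
    setLIntegral_withDensity_eq_setLIntegral_mul _ hf hmI hs,
    setLIntegral_withDensity_eq_setLIntegral_mul _ hg hmO hs, withDensity_apply _ hs]
  exact (lintegral_add_left (hf.mul hmI) _).symm

/-- The survival function of the Erlang distribution. -/
noncomputable def erlangTail (N : ℕ) (r x : ℝ) : ℝ :=
  Real.exp (-(r * x)) * ∑ k ∈ Finset.range N, (r * x) ^ k / k.factorial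

/-- The derivatives of the Poisson terms telescope, so passing from `n` to `n + 1` replaces one
Erlang density by the next. -/
theorem hasDerivAt_neg_erlangTail {N : ℕ} (hN : 1 ≤ N) (r x : ℝ) :
    HasDerivAt (fun x => -erlangTail N r x) (erlangPDF N r x) x := by
  have hexp : HasDerivAt (fun x => Real.exp (-(r * x))) (Real.exp (-(r * x)) * (-r)) x := by
    have : HasDerivAt (fun x => -(r * x)) (-r) x := by
      simpa using ((hasDerivAt_id x).const_mul r).fun_neg
    exact this.exp
  induction N, hN using Nat.le_induction with
  | base =>
    simp only [erlangTail, erlangPDF, Finset.sum_range_one]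
    simpa [mul_comm] using hexp.fun_neg
  | succ n hn ih =>
    have hterm : HasDerivAt (fun x => Real.exp (-(r * x)) * ((r * x) ^ n / n.factorial))
        (Real.exp (-(r * x)) * (-r) * ((r * x) ^ n / n.factorial) +
          Real.exp (-(r * x)) * (n * (r * x) ^ (n - 1) * r / n.factorial)) x := by
      have h1 : HasDerivAt (fun x => r * x) r x := by
        simpa using (hasDerivAt_id x).const_mul r
      exact hexp.fun_mul ((h1.fun_pow n).div_const _)
    have h := ih.fun_sub hterm
    have e : (fun x => -erlangTail (n + 1) r x) = fun x =>
        -erlangTail n r x - Real.exp (-(r * x)) * ((r * x) ^ n / n.factorial) := by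
      funext y
      simp only [erlangTail, Finset.sum_range_succ]
      ring
    rw [e]
    refine h.congr_deriv ?_
    obtain ⟨m, rfl⟩ : ∃ m, n = m + 1 := ⟨n - 1, by omega⟩
    have g1 : Real.Gamma ((m + 1 : ℕ) : ℝ) = m.factorial := by
      rw [← Real.Gamma_nat_eq_factorial]; push_cast; rfl
    have g2 : Real.Gamma ((m + 1 + 1 : ℕ) : ℝ) = (m + 1).factorial := by
      rw [← Real.Gamma_nat_eq_factorial]; push_cast; rfl
    have := Nat.cast_ne_zero (R := ℝ).2 m.factorial_ne_zero
    simp only [erlangPDF, g1, g2, Nat.add_sub_cancel, Nat.factorial_succ]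
    push_cast
    field_simp
    ring

theorem tendsto_erlangTail_atTop (N : ℕ) {r : ℝ} (hr : 0 < r) :
    Filter.Tendsto (erlangTail N r) Filter.atTop (nhds 0) := by
  have h : Filter.Tendsto (fun x => ∑ k ∈ Finset.range N, (r * x) ^ k * Real.exp (-(r * x)) / k.factorial)
      Filter.atTop (nhds (∑ k ∈ Finset.range N, 0 / (k.factorial : ℝ))) := by
    refine tendsto_finsetSum _ fun k _ => Filter.Tendsto.div_const ?_ _
    exact (Real.tendsto_pow_mul_exp_neg_atTop_nhds_zero k).comp
      (Filter.tendsto_id.const_mul_atTop hr)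
  simp only [zero_div, Finset.sum_const_zero] at h
  refine h.congr fun x => ?_
  rw [erlangTail, Finset.mul_sum]
  exact Finset.sum_congr rfl fun k _ => by ring

theorem erlangMeasure_Ioi {N : ℕ} (hN : 1 ≤ N) {r x : ℝ} (hr : 0 < r) (hx : 0 ≤ x) :
    erlangMeasure N r (Ioi x) = ENNReal.ofReal (erlangTail N r x) := by
  have hsub : Ioi x ⊆ Ioi (0 : ℝ) := Ioi_subset_Ioi hx
  have hi := (integrableOn_erlangPDF N hr).mono_set hsub
  rw [erlangMeasure, withDensity_apply _ measurableSet_Ioi, Measure.restrict_restrict measurableSet_Ioi,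
    inter_eq_self_of_subset_left hsub, ← ofReal_integral_eq_lintegral_ofReal hi
      ((ae_restrict_iff' measurableSet_Ioi).2 (ae_of_all _ fun y hy => erlangPDF_nonneg hr (hsub hy))),
    integral_Ioi_of_hasDerivAt_of_tendsto' (fun y _ => hasDerivAt_neg_erlangTail hN r y) hi
      (tendsto_erlangTail_atTop N hr).neg]
  simp

theorem erlangMeasure_Ici {N : ℕ} (hN : 1 ≤ N) {r x : ℝ} (hr : 0 < r) (hx : 0 ≤ x) :
    erlangMeasure N r (Ici x) = ENNReal.ofReal (erlangTail N r x) := by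
  rw [← erlangMeasure_Ioi hN hr hx]
  have h : Ici x =ᵐ[volume.restrict (Ioi (0 : ℝ))] Ioi x := Ioi_ae_eq_Ici.symm
  exact measure_congr ((withDensity_absolutelyContinuous _ _).ae_eq h)

/-- This is the source of the finite sums in the closed form: rates add, and the `k`-th term has
Laplace index `N + k`. -/
theorem erlangPDF_mul_erlangTail {N N' : ℕ} (hN : 1 ≤ N) (r r' x : ℝ) :
    erlangPDF N r x * erlangTail N' r' x = ∑ k ∈ Finset.range N',
      r ^ N * r' ^ k / (Real.Gamma N * k.factorial) *
        (x ^ (N + k - 1) * Real.exp (-((r + r') * x))) := by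
  rw [erlangPDF, erlangTail, Finset.mul_sum, Finset.mul_sum]
  refine Finset.sum_congr rfl fun k _ => ?_
  rw [show N + k - 1 = N - 1 + k by omega, pow_add, mul_pow,
    show -((r + r') * x) = -(r * x) + -(r' * x) by ring, Real.exp_add]
  field_simp

theorem erlangTail_nonneg {N : ℕ} {r x : ℝ} (hr : 0 < r) (hx : 0 ≤ x) : 0 ≤ erlangTail N r x :=
  mul_nonneg (Real.exp_nonneg _) (Finset.sum_nonneg fun k _ => by positivity)

/-- The density of the minimum of two independent Erlang variables. -/
noncomputable def minErlangPDF (N N' : ℕ) (r r' x : ℝ) : ℝ :=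
  erlangPDF N r x * erlangTail N' r' x + erlangPDF N' r' x * erlangTail N r x

theorem map_min_erlangMeasure {N N' : ℕ} (hN : 1 ≤ N) (hN' : 1 ≤ N') {r r' : ℝ} (hr : 0 < r)
    (hr' : 0 < r') :
    ((erlangMeasure N r).prod (erlangMeasure N' r')).map (fun p => min p.1 p.2) =
      (volume.restrict (Ioi 0)).withDensity fun x => ENNReal.ofReal (minErlangPDF N N' r r' x) := by
  have := isFiniteMeasure_erlangMeasure N hr
  have := isFiniteMeasure_erlangMeasure N' hr'
  unfold erlangMeasure at *
  rw [map_min_prod_withDensity (measurable_erlangPDF N r).ennreal_ofReal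
    (measurable_erlangPDF N' r').ennreal_ofReal]
  refine withDensity_congr_ae ((ae_restrict_iff' measurableSet_Ioi).2 (ae_of_all _ fun x hx => ?_))
  have h1 := erlangMeasure_Ici hN' hr' (le_of_lt hx)
  have h2 := erlangMeasure_Ioi hN hr (le_of_lt hx)
  unfold erlangMeasure at h1 h2
  have p1 := erlangPDF_nonneg (N := N) hr hx
  have p2 := erlangPDF_nonneg (N := N') hr' hx
  have t1 := erlangTail_nonneg (N := N) hr (le_of_lt hx)
  have t2 := erlangTail_nonneg (N := N') hr' (le_of_lt hx)
  simp only [h1, h2]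
  rw [← ENNReal.ofReal_mul p1, ← ENNReal.ofReal_mul p2, ← ENNReal.ofReal_add (by positivity) (by positivity)]
  rfl

/-! ### Averages of the logarithm against Erlang densities. -/

theorem integrableOn_laplaceExpLogMean_integrand {M : ℕ} (hM : 1 ≤ M) {x : ℝ} (hx : 0 < x) :
    IntegrableOn (fun u => Real.exp (-(x * u)) * (u ^ (M - 1) * expLogMean u)) (Ioi 0) := by
  have h := (hasMellin_pow_mul_expLogMean hM (w := ((1 / 2 : ℝ) : ℂ))
    (by rw [Complex.ofReal_re]; norm_num) (by rw [Complex.ofReal_re]; norm_num)).1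
  have hm := measurable_expLogMean
  refine (h.norm.const_mul (((M + 1 / 2 : ℝ) / x) ^ (M + 1 / 2 : ℝ))).mono' (by fun_prop) ?_
  refine (ae_restrict_iff' measurableSet_Ioi).2 (ae_of_all _ fun u hu => ?_)
  have e : (1 - (M + ((1 / 2 : ℝ) : ℂ)) - 1 : ℂ) = ((-(M + 1 / 2) : ℝ) : ℂ) := by push_cast; ring
  rw [norm_mul, norm_smul, Real.norm_of_nonneg (Real.exp_nonneg _), e,
    Complex.norm_cpow_eq_rpow_re_of_pos hu, Complex.ofReal_re, Complex.norm_real, ← mul_assoc]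
  exact mul_le_mul_of_nonneg_right (exp_neg_mul_le_rpow (by positivity) hx le_rfl hu) (norm_nonneg _)

theorem laplace_integrand_comp_mul (M : ℕ) {a z : ℝ} (ha : 0 < a) (x : ℝ) :
    x ^ (M - 1) * Real.exp (-(z * x)) * expLogMean (a * x) = (a ^ (M - 1))⁻¹ *
      (Real.exp (-(z / a * (a * x))) * ((a * x) ^ (M - 1) * expLogMean (a * x))) := by
  rw [mul_pow, show z / a * (a * x) = z * x by field_simp]
  field_simp

theorem integrableOn_pow_mul_exp_mul_expLogMean {M : ℕ} (hM : 1 ≤ M) {a z : ℝ} (ha : 0 < a)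
    (hz : 0 < z) :
    IntegrableOn (fun x => x ^ (M - 1) * Real.exp (-(z * x)) * expLogMean (a * x)) (Ioi 0) := by
  simp_rw [laplace_integrand_comp_mul M (z := z) ha]
  refine Integrable.const_mul ?_ _
  exact (integrableOn_Ioi_comp_mul_left_iff
    (fun u => Real.exp (-(z / a * u)) * (u ^ (M - 1) * expLogMean u)) 0 ha).2
    (by rw [mul_zero]; exact integrableOn_laplaceExpLogMean_integrand hM (by positivity))

/-- Substitute `u = a x`: the power gives `a ^ (M - 1)` and the differential one more `a`. -/
theorem integral_pow_mul_exp_mul_expLogMean {M : ℕ} (hM : 1 ≤ M) {a z : ℝ} (ha : 0 < a) :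
    ∫ x in Ioi (0 : ℝ), x ^ (M - 1) * Real.exp (-(z * x)) * expLogMean (a * x) =
      (a ^ M)⁻¹ * laplaceExpLogMean M (z / a) := by
  simp_rw [laplace_integrand_comp_mul M (z := z) ha]
  rw [integral_const_mul, integral_comp_mul_left_Ioi
    (fun u => Real.exp (-(z / a * u)) * (u ^ (M - 1) * expLogMean u)) 0 ha, mul_zero, smul_eq_mul,
    ← mul_assoc, ← mul_inv, ← pow_succ, Nat.sub_add_cancel hM]
  rfl

theorem integral_log_one_add_div_erlangMeasure_one {r : ℝ} (hr : 0 < r) (c : ℝ) :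
    ∫ y, Real.log (1 + c / y) ∂(erlangMeasure 1 r) = expLogMean (c * r) := by
  rw [integral_erlangMeasure _ hr, expLogMean]
  have h := integral_comp_mul_left_Ioi (fun t => Real.exp (-t) * Real.log (1 + c * r / t)) 0 hr
  rw [mul_zero, smul_eq_mul, eq_inv_mul_iff_mul_eq₀ hr.ne', ← integral_const_mul] at h
  rw [← h]
  refine setIntegral_congr_fun measurableSet_Ioi fun y hy => ?_
  have e : c * r / (r * y) = c / y := by rw [mul_comm c r, mul_div_mul_left _ _ hr.ne']
  simp only [erlangPDF, e, smul_eq_mul]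
  simp [mul_assoc]

theorem integrable_erlangMeasure_iff (N : ℕ) {r : ℝ} (hr : 0 < r) (f : ℝ → ℝ) :
    Integrable f (erlangMeasure N r) ↔ IntegrableOn (fun x => erlangPDF N r x * f x) (Ioi 0) := by
  rw [erlangMeasure, integrable_withDensity_iff_integrable_smul'
    (measurable_erlangPDF N r).ennreal_ofReal (ae_of_all _ fun x => ENNReal.ofReal_lt_top)]
  refine integrableOn_congr_fun (fun x hx => ?_) measurableSet_Ioi
  simp only [ENNReal.toReal_ofReal (erlangPDF_nonneg hr hx), smul_eq_mul]

theorem ae_pos_erlangMeasure (N : ℕ) (r : ℝ) : ∀ᵐ x ∂(erlangMeasure N r), 0 < x := by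
  have h : ∀ᵐ x ∂(volume.restrict (Ioi (0 : ℝ))), 0 < x := ae_restrict_mem measurableSet_Ioi
  exact (withDensity_absolutelyContinuous _ _).ae_le h

theorem log_one_add_le_two_mul_sqrt {y : ℝ} (hy : 0 ≤ y) : Real.log (1 + y) ≤ 2 * √y := by
  have h1 : Real.log (√(1 + y)) = Real.log (1 + y) / 2 := Real.log_sqrt (by linarith)
  have h2 := Real.log_le_sub_one_of_pos (Real.sqrt_pos.2 (show 0 < 1 + y by linarith))
  have h3 : √(1 + y) ≤ 1 + √y := by
    rw [Real.sqrt_le_left (by positivity)]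
    nlinarith [Real.sq_sqrt hy, Real.sqrt_nonneg y]
  linarith

/-- `1 / Y` is not integrable for exponential `Y`, but `1 / √Y` is. The bound `log (1 + y) ≤ 2 √y`
therefore suffices, since independence makes the product of `√X` and `1 / √Y` integrable. -/
theorem integrable_log_one_add_mul_div [MeasurableSpace S] {μ : Measure S} {X Y : S → ℝ} {N : ℕ}
    {s r β : ℝ} (hs : 0 < s) (hr : 0 < r) (hβ : 0 ≤ β)
    (hX : HasLaw X (erlangMeasure N s) μ) (hY : HasLaw Y (erlangMeasure 1 r) μ)
    (hXY : IndepFun X Y μ) :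
    Integrable (fun ω => Real.log (1 + β * X ω / Y ω)) μ := by
  have hX0 : ∀ᵐ ω ∂μ, 0 < X ω :=
    ae_of_ae_map hX.aemeasurable (by rw [hX.map_eq]; exact ae_pos_erlangMeasure N s)
  have hY0 : ∀ᵐ ω ∂μ, 0 < Y ω :=
    ae_of_ae_map hY.aemeasurable (by rw [hY.map_eq]; exact ae_pos_erlangMeasure 1 r)
  have iX : Integrable (fun ω => √(X ω)) μ := by
    have h : Integrable (fun x => √x) (erlangMeasure N s) := by
      have hfin := isFiniteMeasure_erlangMeasure N hs
      have h1 : Integrable (fun x => x) (erlangMeasure N s) := by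
        rw [integrable_erlangMeasure_iff N hs]
        have := (integrableOn_pow_mul_exp_neg_mul (N - 1 + 1) hs).const_mul (s ^ N / Real.Gamma N)
        refine IntegrableOn.congr_fun this (fun x hx => ?_) measurableSet_Ioi
        simp only [erlangPDF, pow_succ]; ring
      refine ((integrable_const 1).add h1).mono' (by fun_prop) ?_
      filter_upwards [ae_pos_erlangMeasure N s] with x hx
      rw [Real.norm_of_nonneg (Real.sqrt_nonneg _)]
      simp only [Pi.add_apply]
      nlinarith [Real.sq_sqrt hx.le, sq_nonneg (√x - 1)]
    rw [← hX.map_eq] at h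
    exact h.comp_aemeasurable hX.aemeasurable
  have iY : Integrable (fun ω => (√(Y ω))⁻¹) μ := by
    have h : Integrable (fun y => (√y)⁻¹) (erlangMeasure 1 r) := by
      rw [integrable_erlangMeasure_iff 1 hr]
      have := (integrableOn_rpow_mul_exp_neg_mul_rpow (s := -(1 / 2)) (p := 1) (by norm_num)
        one_pos hr).const_mul r
      refine IntegrableOn.congr_fun this (fun y hy => ?_) measurableSet_Ioi
      simp only [erlangPDF]
      rw [Real.sqrt_eq_rpow, ← Real.rpow_neg (le_of_lt hy)]
      simp
      ring
    rw [← hY.map_eq] at h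
    exact h.comp_aemeasurable hY.aemeasurable
  have hind : IndepFun (fun ω => √(X ω)) (fun ω => (√(Y ω))⁻¹) μ :=
    hXY.comp (φ := fun x => √x) (ψ := fun y => (√y)⁻¹) (by fun_prop) (by fun_prop)
  have hprod := (hind.integrable_mul iX iY).const_mul (2 * √β)
  have hmX := hX.aemeasurable
  have hmY := hY.aemeasurable
  refine hprod.mono' (AEMeasurable.aestronglyMeasurable (by fun_prop)) ?_
  filter_upwards [hX0, hY0] with ω h1 h2
  have h3 : 0 ≤ β * X ω / Y ω := by positivity
  rw [Real.norm_of_nonneg (Real.log_nonneg (by linarith))]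
  refine (log_one_add_le_two_mul_sqrt h3).trans (le_of_eq ?_)
  rw [Real.sqrt_div (by positivity), Real.sqrt_mul hβ, Pi.mul_apply]
  ring

/-- Fubini on the joint law: for fixed `X = x`, the scaled variable `r * Y` is standard exponential
and its average is `expLogMean (β * r * x)`. -/
theorem integral_log_one_add_mul_div [MeasurableSpace S] {μ : Measure S} [IsProbabilityMeasure μ]
    {X Y : S → ℝ} {r β : ℝ} {f : ℝ → ℝ} (hr : 0 < r) (hf : Measurable f) (hf0 : ∀ x, 0 < x → 0 ≤ f x)
    (hX : HasLaw X ((volume.restrict (Ioi 0)).withDensity fun x => ENNReal.ofReal (f x)) μ)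
    (hY : HasLaw Y (erlangMeasure 1 r) μ) (hXY : IndepFun X Y μ)
    (hint : Integrable (fun ω => Real.log (1 + β * X ω / Y ω)) μ) :
    ∫ ω, Real.log (1 + β * X ω / Y ω) ∂μ = ∫ x in Ioi (0 : ℝ), f x * expLogMean (β * r * x) := by
  have hpX := Measure.isProbabilityMeasure_map (μ := μ) hX.aemeasurable
  have hpY := Measure.isProbabilityMeasure_map (μ := μ) hY.aemeasurable
  have hpair : AEMeasurable (fun ω => (X ω, Y ω)) μ := hX.aemeasurable.prodMk hY.aemeasurable
  have hmap := (indepFun_iff_map_prod_eq_prod_map_map hX.aemeasurable hY.aemeasurable).1 hXY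
  have hmeas : Measurable fun p : ℝ × ℝ => Real.log (1 + β * p.1 / p.2) := by fun_prop
  have hint2 : Integrable (fun p : ℝ × ℝ => Real.log (1 + β * p.1 / p.2))
      ((μ.map X).prod (μ.map Y)) := by
    rw [← hmap]
    exact (integrable_map_measure hmeas.aestronglyMeasurable hpair).2 hint
  have e1 := integral_map hpair (f := fun p : ℝ × ℝ => Real.log (1 + β * p.1 / p.2))
    hmeas.aestronglyMeasurable
  rw [← e1, hmap, integral_prod _ hint2, hX.map_eq, hY.map_eq]
  simp_rw [integral_log_one_add_div_erlangMeasure_one hr]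
  rw [integral_withDensity_eq_integral_toReal_smul hf.ennreal_ofReal
    (ae_of_all _ fun x => ENNReal.ofReal_lt_top)]
  refine setIntegral_congr_fun measurableSet_Ioi fun x hx => ?_
  simp only [ENNReal.toReal_ofReal (hf0 x hx), smul_eq_mul]
  congr 2; ring

theorem integral_erlangPDF_mul_expLogMean {N : ℕ} (hN : 1 ≤ N) (r : ℝ) {a : ℝ} (ha : 0 < a) :
    ∫ x in Ioi (0 : ℝ), erlangPDF N r x * expLogMean (a * x) =
      r ^ N / Real.Gamma N * ((a ^ N)⁻¹ * laplaceExpLogMean N (r / a)) := by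
  rw [← integral_pow_mul_exp_mul_expLogMean hN ha, ← integral_const_mul]
  simp only [erlangPDF, mul_assoc]

theorem hasIntegral_erlangPDF_mul_erlangTail {N : ℕ} (hN : 1 ≤ N) (N' : ℕ) {r r' a : ℝ}
    (hr : 0 < r) (hr' : 0 < r') (ha : 0 < a) :
    IntegrableOn (fun x => erlangPDF N r x * erlangTail N' r' x * expLogMean (a * x)) (Ioi 0) ∧
    ∫ x in Ioi (0 : ℝ), erlangPDF N r x * erlangTail N' r' x * expLogMean (a * x) =
      ∑ k ∈ Finset.range N', r ^ N * r' ^ k / (Real.Gamma N * k.factorial) *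
        ((a ^ (N + k))⁻¹ * laplaceExpLogMean (N + k) ((r + r') / a)) := by
  have hint : ∀ k ∈ Finset.range N', IntegrableOn (fun x =>
      r ^ N * r' ^ k / (Real.Gamma N * k.factorial) *
        (x ^ (N + k - 1) * Real.exp (-((r + r') * x)) * expLogMean (a * x))) (Ioi 0) := fun k _ =>
    (integrableOn_pow_mul_exp_mul_expLogMean (by omega) ha (by positivity)).const_mul _
  simp_rw [erlangPDF_mul_erlangTail hN, Finset.sum_mul, mul_assoc (_ / _)]
  refine ⟨integrable_finsetSum _ hint, ?_⟩
  rw [integral_finsetSum _ hint]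
  refine Finset.sum_congr rfl fun k _ => ?_
  rw [integral_const_mul, integral_pow_mul_exp_mul_expLogMean (by omega) ha]

theorem integral_minErlangPDF_mul_expLogMean {N N' : ℕ} (hN : 1 ≤ N) (hN' : 1 ≤ N') {r r' a : ℝ}
    (hr : 0 < r) (hr' : 0 < r') (ha : 0 < a) :
    ∫ x in Ioi (0 : ℝ), minErlangPDF N N' r r' x * expLogMean (a * x) =
      ∑ k ∈ Finset.range N', r ^ N * r' ^ k / (Real.Gamma N * k.factorial) *
        ((a ^ (N + k))⁻¹ * laplaceExpLogMean (N + k) ((r + r') / a)) +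
      ∑ l ∈ Finset.range N, r' ^ N' * r ^ l / (Real.Gamma N' * l.factorial) *
        ((a ^ (N' + l))⁻¹ * laplaceExpLogMean (N' + l) ((r + r') / a)) := by
  have h1 := hasIntegral_erlangPDF_mul_erlangTail hN N' hr hr' ha
  have h2 := hasIntegral_erlangPDF_mul_erlangTail hN' N hr' hr ha
  simp_rw [minErlangPDF, add_mul]
  rw [integral_add h1.1 h2.1, h1.2, h2.2, add_comm r' r]

/-! ### The instantaneous sum-rate, the optimal policy and independence of the gains. -/

theorem mrcGain_nonneg {N : ℕ} (h : Fin N → S → ℂ) (ω : S) : 0 ≤ mrcGain h ω :=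
  Finset.sum_nonneg fun _ _ => by positivity

/-- Because `an + af = 1`, the argument of the second logarithm is `(1 + m P) / (1 + an m P)` with
`m` the smaller gain. -/
theorem sumRate_eq {an af gn gf P : ℝ} (han : 0 < an) (hsum : an + af = 1) (hgn : 0 ≤ gn)
    (hgf : 0 ≤ gf) (hP : 0 ≤ P) :
    sumRate an af gn gf P = 1 / Real.log 2 * (Real.log (1 + an * gn * P) +
      (Real.log (1 + min gn gf * P) - Real.log (1 + an * min gn gf * P))) := by
  have hm : 0 ≤ min gn gf * P := mul_nonneg (le_min hgn hgf) hP
  have h1 : 0 < an * min gn gf * P + 1 := by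
    rw [mul_assoc]; positivity
  have e : 1 + af * min gn gf * P / (an * min gn gf * P + 1) =
      (1 + min gn gf * P) / (1 + an * min gn gf * P) := by
    rw [add_comm 1 (an * min gn gf * P), eq_div_iff h1.ne', add_mul, div_mul_cancel₀ _ h1.ne']
    linear_combination min gn gf * P * hsum
  rw [sumRate, Real.logb, Real.logb, e, Real.log_div (by positivity) (by linarith)]
  ring

theorem sumRate_nonneg {an af gn gf P : ℝ} (han : 0 < an) (haf : 0 < af) (hgn : 0 ≤ gn)
    (hgf : 0 ≤ gf) (hP : 0 ≤ P) : 0 ≤ sumRate an af gn gf P := by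
  have hm : 0 ≤ min gn gf := le_min hgn hgf
  exact add_nonneg (Real.logb_nonneg one_lt_two (le_add_of_nonneg_right (by positivity)))
    (Real.logb_nonneg one_lt_two (le_add_of_nonneg_right (by positivity)))

theorem sumRate_mono {an af gn gf P Q : ℝ} (han : 0 < an) (haf : 0 < af) (hgn : 0 ≤ gn)
    (hgf : 0 ≤ gf) (hP : 0 ≤ P) (hPQ : P ≤ Q) : sumRate an af gn gf P ≤ sumRate an af gn gf Q := by
  have hm : 0 ≤ min gn gf := le_min hgn hgf
  have hQ : 0 ≤ Q := hP.trans hPQ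
  refine add_le_add (Real.logb_le_logb_of_le one_lt_two (by positivity) (by gcongr))
    (Real.logb_le_logb_of_le one_lt_two (by positivity) (add_le_add le_rfl ?_))
  rw [div_le_div_iff₀ (by positivity) (by positivity)]
  have := mul_le_mul_of_nonneg_left hPQ (mul_nonneg haf.le hm)
  nlinarith

theorem isAdmissiblePolicy_div {J : ℝ} (hJ : 0 < J) : IsAdmissiblePolicy J fun g => J / g := by
  refine ⟨by fun_prop, fun g hg => ⟨by positivity, ?_⟩⟩
  -- At `g = 0` the quotient is `0` by convention, and the constraint reads `0 ≤ J`.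
  rcases hg.eq_or_lt with rfl | h
  · simpa using hJ.le
  · rw [mul_div_cancel₀ _ h.ne']

section Gains

variable [MeasurableSpace S] {μ : Measure S} {N N' : ℕ} {hp : S → ℂ} {hn : Fin N → S → ℂ}
  {hf : Fin N' → S → ℂ}

/-- Functions of disjoint blocks of an independent family are independent. The pair of gains is kept
jointly independent of `‖hp‖²` so that the minimum inherits this. -/
theorem indepFun_mrcGain (mn : ∀ i, AEMeasurable (hn i) μ) (mf : ∀ i, AEMeasurable (hf i) μ)
    (mp : AEMeasurable hp μ)
    (h : iIndepFun (Sum.elim (fun _ : Unit => hp) (Sum.elim hn hf)) μ) :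
    IndepFun (mrcGain hn) (mrcGain hf) μ ∧
    IndepFun (fun ω => (mrcGain hn ω, mrcGain hf ω)) (fun ω => ‖hp ω‖ ^ 2) μ := by
  classical
  have hm : ∀ i, AEMeasurable (Sum.elim (fun _ : Unit => hp) (Sum.elim hn hf) i) μ := by
    rintro (_ | i | i)
    exacts [mp, mn i, mf i]
  let A : Finset (Unit ⊕ (Fin N ⊕ Fin N')) := Finset.univ.image fun i => Sum.inr (Sum.inl i)
  let B : Finset (Unit ⊕ (Fin N ⊕ Fin N')) := Finset.univ.image fun i => Sum.inr (Sum.inr i)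
  let C : Finset (Unit ⊕ (Fin N ⊕ Fin N')) := {Sum.inl ()}
  have hA : ∀ i, Sum.inr (Sum.inl i) ∈ A := fun i => Finset.mem_image_of_mem _ (Finset.mem_univ i)
  have hB : ∀ i, Sum.inr (Sum.inr i) ∈ B := fun i => Finset.mem_image_of_mem _ (Finset.mem_univ i)
  have hC : Sum.inl () ∈ C := Finset.mem_singleton_self _
  have hAB : Disjoint A B := by
    rw [Finset.disjoint_left]; simp [A, B]
  have hABC : Disjoint (A ∪ B) C := by
    rw [Finset.disjoint_left]; simp [A, B, C]
  have h1 := h.indepFun_finset₀ A B hAB hm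
  have h2 := h.indepFun_finset₀ (A ∪ B) C hABC hm
  constructor
  · exact h1.comp (φ := fun z : A → ℂ => ∑ i, ‖z ⟨_, hA i⟩‖ ^ 2)
      (ψ := fun z : B → ℂ => ∑ i, ‖z ⟨_, hB i⟩‖ ^ 2) (by fun_prop) (by fun_prop)
  · exact h2.comp (φ := fun z : (A ∪ B : Finset _) → ℂ =>
        (∑ i, ‖z ⟨_, Finset.mem_union_left _ (hA i)⟩‖ ^ 2,
          ∑ i, ‖z ⟨_, Finset.mem_union_right _ (hB i)⟩‖ ^ 2))
      (ψ := fun z : C → ℂ => ‖z ⟨_, hC⟩‖ ^ 2) (by fun_prop) (by fun_prop)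

end Gains

theorem measurable_erlangTail (N : ℕ) (r : ℝ) : Measurable (erlangTail N r) := by
  unfold erlangTail; fun_prop

theorem measurable_minErlangPDF (N N' : ℕ) (r r' : ℝ) : Measurable (minErlangPDF N N' r r') :=
  ((measurable_erlangPDF N r).mul (measurable_erlangTail N' r')).add
    ((measurable_erlangPDF N' r').mul (measurable_erlangTail N r))

theorem minErlangPDF_nonneg {N N' : ℕ} {r r' x : ℝ} (hr : 0 < r) (hr' : 0 < r') (hx : 0 < x) :
    0 ≤ minErlangPDF N N' r r' x :=
  add_nonneg (mul_nonneg (erlangPDF_nonneg hr hx) (erlangTail_nonneg hr' hx.le))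
    (mul_nonneg (erlangPDF_nonneg hr' hx) (erlangTail_nonneg hr hx.le))

/-! ### The sum-rate capacity. -/

theorem theorem1 {S : Type*} [MeasurableSpace S] (μ : Measure S) [IsProbabilityMeasure μ]
    (Nn Nf : ℕ) (hNn : 1 ≤ Nn) (hNf : 1 ≤ Nf)
    (Ωp Ωn Ωf : ℝ) (hΩp : 0 < Ωp) (hΩn : 0 < Ωn) (hΩf : 0 < Ωf)
    (an af : ℝ) (han : 0 < an) (haf : 0 < af) (hsum : an + af = 1)
    (I : ℝ) (hI : 0 < I)
    (hp : S → ℂ) (hn : Fin Nn → S → ℂ) (hf : Fin Nf → S → ℂ)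
    (hp_law : HasLaw hp (circularGaussian Ωp) μ)
    (hn_law : ∀ i, HasLaw (hn i) (circularGaussian Ωn) μ)
    (hf_law : ∀ j, HasLaw (hf j) (circularGaussian Ωf) μ)
    (h_indep : iIndepFun (Sum.elim (fun _ : Unit => hp) (Sum.elim hn hf)) μ)
    (Ω : ℝ) (hΩ : Ω = Ωn * Ωf / (Ωn + Ωf)) :
    -- the expectations are finite, and the maximum over all policies is attained at `I / g_p`
    (∀ P : ℝ → ℝ, IsAdmissiblePolicy I P → Integrable (randomSumRate an af hp hn hf P) μ) ∧
    IsGreatest {r : ℝ | ∃ P : ℝ → ℝ, IsAdmissiblePolicy I P ∧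
        r = expectedSumRate μ an af hp hn hf P}
      (expectedSumRate μ an af hp hn hf (fun g => I / g)) ∧
    -- the Meijer G-functions in the closed form are given by convergent integrals
    (∀ M : ℕ, 1 ≤ M → ∀ x : ℝ, 0 < x →
      HasMeijerG 3 2 (upperParams M) (lowerParams M) (x : ℂ) (rateG M x)) ∧
    -- the closed form of the maximum
    (expectedSumRate μ an af hp hn hf (fun g => I / g) : ℂ) =
      ((1 / Real.log 2 : ℝ) : ℂ) *
        (((1 / Real.Gamma Nn * (Ωp / (Ωn * an * I)) ^ Nn : ℝ) : ℂ) * rateG Nn (Ωp / (Ωn * an * I)) +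
         (∑ k ∈ Finset.range Nf,
            ((Ωp ^ (Nn + k) /
              (Real.Gamma Nn * Nat.factorial k * Ωn ^ Nn * Ωf ^ k * I ^ (Nn + k)) : ℝ) : ℂ) *
            (rateG (Nn + k) (Ωp / (Ω * I)) -
              ((1 / an ^ (Nn + k) : ℝ) : ℂ) * rateG (Nn + k) (Ωp / (Ω * an * I)))) +
         (∑ l ∈ Finset.range Nn,
            ((Ωp ^ (Nf + l) /
              (Real.Gamma Nf * Nat.factorial l * Ωf ^ Nf * Ωn ^ l * I ^ (Nf + l)) : ℝ) : ℂ) *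
            (rateG (Nf + l) (Ωp / (Ω * I)) -
              ((1 / an ^ (Nf + l) : ℝ) : ℂ) * rateG (Nf + l) (Ωp / (Ω * an * I))))) := by
  have hrp : 0 < Ωp⁻¹ := inv_pos.2 hΩp
  have hrn : 0 < Ωn⁻¹ := inv_pos.2 hΩn
  have hrf : 0 < Ωf⁻¹ := inv_pos.2 hΩf
  set X := mrcGain hn with hXdef
  set Z := mrcGain hf with hZdef
  set Y : S → ℝ := fun ω => ‖hp ω‖ ^ 2 with hYdef
  have mp := hp_law.aemeasurable
  have mn := fun i => (hn_law i).aemeasurable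
  have mf := fun i => (hf_law i).aemeasurable
  have hX : HasLaw X (erlangMeasure Nn Ωn⁻¹) μ := hasLaw_mrcGain hNn hΩn hn_law
    (h_indep.precomp (g := fun i => Sum.inr (Sum.inl i))
      fun i j h => Sum.inl_injective (Sum.inr_injective h))
  have hZ : HasLaw Z (erlangMeasure Nf Ωf⁻¹) μ := hasLaw_mrcGain hNf hΩf hf_law
    (h_indep.precomp (g := fun i => Sum.inr (Sum.inr i))
      fun i j h => Sum.inr_injective (Sum.inr_injective h))
  -- The interference gain is the one-antenna case of `hasLaw_mrcGain`.
  have hY : HasLaw Y (erlangMeasure 1 Ωp⁻¹) μ := by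
    have h := hasLaw_mrcGain (N := 1) (h := fun _ => hp) le_rfl hΩp (fun _ => hp_law)
      (h_indep.precomp (g := fun _ : Fin 1 => Sum.inl ()) fun i j _ => Subsingleton.elim i j)
    have e : mrcGain (fun _ : Fin 1 => hp) = Y := by
      funext ω; simp [mrcGain, hYdef]
    rwa [e] at h
  obtain ⟨hXZ, hXZY⟩ := indepFun_mrcGain mn mf mp h_indep
  have hXY : IndepFun X Y μ := hXZY.comp (φ := Prod.fst) (ψ := id) (by fun_prop) (by fun_prop)
  have hWY : IndepFun (fun ω => min (X ω) (Z ω)) Y μ :=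
    hXZY.comp (φ := fun p : ℝ × ℝ => min p.1 p.2) (ψ := id) (by fun_prop) (by fun_prop)
  have hW : HasLaw (fun ω => min (X ω) (Z ω)) ((volume.restrict (Ioi 0)).withDensity fun x =>
      ENNReal.ofReal (minErlangPDF Nn Nf Ωn⁻¹ Ωf⁻¹ x)) μ := by
    have := Measure.isProbabilityMeasure_map (μ := μ) hX.aemeasurable
    have := Measure.isProbabilityMeasure_map (μ := μ) hZ.aemeasurable
    have hpair := hX.aemeasurable.prodMk hZ.aemeasurable
    refine ⟨hX.aemeasurable.min hZ.aemeasurable, ?_⟩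
    rw [← map_min_erlangMeasure hNn hNf hrn hrf, ← hX.map_eq, ← hZ.map_eq,
      ← (indepFun_iff_map_prod_eq_prod_map_map hX.aemeasurable hZ.aemeasurable).1 hXZ,
      AEMeasurable.map_map_of_aemeasurable (by fun_prop) hpair]
    rfl
  have hX0 : ∀ ω, 0 ≤ X ω := mrcGain_nonneg hn
  have hZ0 : ∀ ω, 0 ≤ Z ω := mrcGain_nonneg hf
  have hY0 : ∀ ω, 0 ≤ Y ω := fun ω => by positivity
  have hYpos : ∀ᵐ ω ∂μ, 0 < Y ω :=
    ae_of_ae_map hY.aemeasurable (by rw [hY.map_eq]; exact ae_pos_erlangMeasure 1 _)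
  have iX : ∀ β : ℝ, 0 ≤ β → Integrable (fun ω => Real.log (1 + β * X ω / Y ω)) μ := fun β hβ =>
    integrable_log_one_add_mul_div hrn hrp hβ hX hY hXY
  have mX := hX.aemeasurable
  have mZ := hZ.aemeasurable
  have mY := hY.aemeasurable
  have iW : ∀ β : ℝ, 0 ≤ β → Integrable (fun ω => Real.log (1 + β * min (X ω) (Z ω) / Y ω)) μ := by
    intro β hβ
    refine (iX β hβ).mono' (AEMeasurable.aestronglyMeasurable (by fun_prop)) (ae_of_all _ fun ω => ?_)
    have h1 : 0 ≤ β * min (X ω) (Z ω) / Y ω :=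
      div_nonneg (mul_nonneg hβ (le_min (hX0 ω) (hZ0 ω))) (hY0 ω)
    rw [Real.norm_of_nonneg (Real.log_nonneg (by linarith))]
    refine Real.log_le_log (by linarith) (add_le_add le_rfl ?_)
    exact div_le_div_of_nonneg_right (mul_le_mul_of_nonneg_left (min_le_left _ _) hβ) (hY0 ω)
  have hrate : randomSumRate an af hp hn hf (fun g => I / g) = fun ω => 1 / Real.log 2 *
      (Real.log (1 + an * I * X ω / Y ω) + (Real.log (1 + I * min (X ω) (Z ω) / Y ω) -
        Real.log (1 + an * I * min (X ω) (Z ω) / Y ω))) := by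
    funext ω
    rw [randomSumRate, sumRate_eq han hsum (hX0 ω) (hZ0 ω) (div_nonneg hI.le (hY0 ω))]
    congr 4 <;> ring
  have iopt : Integrable (randomSumRate an af hp hn hf fun g => I / g) μ := by
    rw [hrate]
    exact ((iX _ (by positivity)).add ((iW _ hI.le).sub (iW _ (by positivity)))).const_mul _
  -- Only almost surely: where the interference gain is `0`, the constraint does not bound `P` while
  -- `I / 0 = 0`.
  have hle : ∀ P : ℝ → ℝ, IsAdmissiblePolicy I P → ∀ᵐ ω ∂μ,
      randomSumRate an af hp hn hf P ω ≤ randomSumRate an af hp hn hf (fun g => I / g) ω := by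
    intro P hP
    filter_upwards [hYpos] with ω hω
    refine sumRate_mono han haf (hX0 ω) (hZ0 ω) (hP.2 _ (hY0 ω)).1 ?_
    rw [le_div_iff₀ hω, mul_comm]
    exact (hP.2 _ (hY0 ω)).2
  have hint : ∀ P : ℝ → ℝ, IsAdmissiblePolicy I P →
      Integrable (randomSumRate an af hp hn hf P) μ := by
    intro P hP
    have hPm := hP.1
    have hPY : AEMeasurable (fun ω => P (Y ω)) μ := hPm.comp_aemeasurable mY
    -- Rates are nonnegative, so the optimal rate dominates every other one.
    refine iopt.mono' ?_ ?_
    · refine AEMeasurable.aestronglyMeasurable ?_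
      change AEMeasurable (fun ω => sumRate an af (X ω) (Z ω) (P (Y ω))) μ
      unfold sumRate Real.logb
      fun_prop
    · filter_upwards [hle P hP] with ω hω
      rw [Real.norm_of_nonneg]
      · exact hω
      · exact sumRate_nonneg han haf (hX0 ω) (hZ0 ω) (hP.2 _ (hY0 ω)).1
  refine ⟨hint, ⟨⟨_, isAdmissiblePolicy_div hI, rfl⟩, ?_⟩, fun M hM x hx =>
    (hasMeijerG_rateG hM hx).2, ?_⟩
  · rintro r ⟨P, hP, rfl⟩
    exact integral_mono_ae (hint P hP) iopt (hle P hP)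
  have eX : ∀ β : ℝ, 0 < β → ∫ ω, Real.log (1 + β * X ω / Y ω) ∂μ =
      Ωn⁻¹ ^ Nn / Real.Gamma Nn *
        (((β * Ωp⁻¹) ^ Nn)⁻¹ * laplaceExpLogMean Nn (Ωn⁻¹ / (β * Ωp⁻¹))) := fun β hβ => by
    rw [integral_log_one_add_mul_div hrp (measurable_erlangPDF Nn Ωn⁻¹)
      (fun x hx => erlangPDF_nonneg hrn hx) hX hY hXY (iX β hβ.le),
      integral_erlangPDF_mul_expLogMean hNn _ (by positivity)]
  have eW : ∀ β : ℝ, 0 < β → ∫ ω, Real.log (1 + β * min (X ω) (Z ω) / Y ω) ∂μ = _ := fun β hβ =>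
    (integral_log_one_add_mul_div hrp (measurable_minErlangPDF Nn Nf Ωn⁻¹ Ωf⁻¹)
      (fun x hx => minErlangPDF_nonneg hrn hrf hx) hW hY hWY (iW β hβ.le)).trans
      (integral_minErlangPDF_mul_expLogMean hNn hNf hrn hrf (by positivity))
  have hE : expectedSumRate μ an af hp hn hf (fun g => I / g) = 1 / Real.log 2 *
      (∫ ω, Real.log (1 + an * I * X ω / Y ω) ∂μ +
        (∫ ω, Real.log (1 + I * min (X ω) (Z ω) / Y ω) ∂μ -
          ∫ ω, Real.log (1 + an * I * min (X ω) (Z ω) / Y ω) ∂μ)) := by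
    have haI : 0 ≤ an * I := by positivity
    rw [expectedSumRate, hrate, integral_const_mul, ← integral_sub (iW _ hI.le) (iW _ haI)]
    exact congrArg _ (integral_add (iX _ haI) ((iW _ hI.le).sub (iW _ haI)))
  have hΩ0 : 0 < Ω := by rw [hΩ]; positivity
  have rG : ∀ M : ℕ, 1 ≤ M → ∀ x : ℝ, 0 < x → rateG M x = laplaceExpLogMean M x :=
    fun M hM x hx => (hasMeijerG_rateG hM hx).1
  -- The Laplace arguments become the Meijer arguments; for the minimum the rates add up to `1 / Ω`.
  have a1 : Ωn⁻¹ / (an * I * Ωp⁻¹) = Ωp / (Ωn * an * I) := by field_simp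
  have a2 : (Ωn⁻¹ + Ωf⁻¹) / (I * Ωp⁻¹) = Ωp / (Ω * I) := by rw [hΩ]; field_simp; ring
  have a3 : (Ωn⁻¹ + Ωf⁻¹) / (an * I * Ωp⁻¹) = Ωp / (Ω * an * I) := by rw [hΩ]; field_simp; ring
  rw [hE, eX _ (by positivity), eW _ hI, eW _ (by positivity), a1, a2, a3, rG Nn hNn _ (by positivity)]
  simp_rw [rG (Nn + _) (Nat.le_add_right_of_le hNn) (Ωp / (Ω * I)) (by positivity),
    rG (Nn + _) (Nat.le_add_right_of_le hNn) (Ωp / (Ω * an * I)) (by positivity),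
    rG (Nf + _) (Nat.le_add_right_of_le hNf) (Ωp / (Ω * I)) (by positivity),
    rG (Nf + _) (Nat.le_add_right_of_le hNf) (Ωp / (Ω * an * I)) (by positivity)]
  norm_cast
  -- The two averages over the minimum, with `β = I` and `β = an * I`, are paired term by term to
  -- form the braces of the closed form.
  rw [add_sub_add_comm, ← add_assoc, ← Finset.sum_sub_distrib, ← Finset.sum_sub_distrib]
  have hGn := Real.Gamma_pos_of_pos (show (0 : ℝ) < Nn by positivity)
  have hGf := Real.Gamma_pos_of_pos (show (0 : ℝ) < Nf by positivity)
  refine congrArg _ (congrArg₂ _ (congrArg₂ _ ?_ (Finset.sum_congr rfl fun k _ => ?_))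
    (Finset.sum_congr rfl fun l _ => ?_))
  · generalize laplaceExpLogMean Nn (Ωp / (Ωn * an * I)) = A
    simp only [div_pow, mul_pow, inv_pow]
    field_simp
  · generalize laplaceExpLogMean (Nn + k) (Ωp / (Ω * I)) = A
    generalize laplaceExpLogMean (Nn + k) (Ωp / (Ω * an * I)) = B
    have := Nat.cast_pos (α := ℝ).2 k.factorial_pos
    simp only [mul_pow, inv_pow]
    field_simp
  · generalize laplaceExpLogMean (Nf + l) (Ωp / (Ω * I)) = A
    generalize laplaceExpLogMean (Nf + l) (Ωp / (Ω * an * I)) = B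
    have := Nat.cast_pos (α := ℝ).2 l.factorial_pos
    simp only [mul_pow, inv_pow]
    field_simp
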